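/- **Setting.** Let $q\in[-1,1]$. For a complex inner product space $\mathcal H$ (inner product linear in the first variable), let $\mathcal F_q(\mathcal H)$ be the space of finite sums in $\mathbb C\Omega_q\oplus\bigoplus_{n\ge1}\mathcal H^{\otimes n}$ with $$\langle g_1\otimes\cdots\otimes g_n,\;h_1\otimes\cdots\otimes h_m\rangle_q=\delta_{n,m}\sum_{\sigma\in S_n}q^{\mathrm{inv}(\sigma)}\prod_{k=1}^n\langle g_k,h_{\sigma(k)}\rangle ,\qquad \mathrm{inv}(\sigma)=|\{(i,j): i<j,\ \sigma(i)>\sigma(j)\}|$$ (with $0^0=1$), modulo the vectors orthogonal to the whole space. Let $\varphi_q(T)=\langle T\Omega_q,\Omega_q\rangle_q$ for linear operators $T$ on $\mathcal F_q(\mathcal H)$. For $h\in\mathcal H$ the left and right creation operators $a(h),b(h)$ and annihilation operators $a^*(h),b^*(h)$ are the linear operators on $\mathcal F_q(\mathcal H)$ with $a(h)\Omega_q=b(h)\Omega_q=h$, $a^*(h)\Omega_q=b^*(h)\Omega_q=0$ and $$a(h)(h_1\otimes\cdots\otimes h_n)=h\otimes h_1\otimes\cdots\otimes h_n,\qquad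 b(h)(h_1\otimes\cdots\otimes h_n)=h_1\otimes\cdots\otimes h_n\otimes h,$$ $$a^*(h)(h_1\otimes\cdots\otimes h_n)=\sum_{k=1}^nq^{k-1}\langle h_k,h\rangle\,h_1\otimes\cdots\check{h_k}\cdots\otimes h_n,\qquad b^*(h)(h_1\otimes\cdots\otimes h_n)=\sum_{k=1}^nq^{n-k}\langle h_k,h\rangle\,h_1\otimes\cdots\check{h_k}\cdots\otimes h_n,$$ where $\check{h_k}$ means that $h_k$ is omitted. For $q=0$ this is the full Fock space, and $a,b,a^*,b^*$ are then written $l,r,l^*,r^*$. Let $K$ be a set. For each $N\in\mathbb N$ let $\{h^k_{i,j}: 1\le i,j\le N,\ k\in K\}$ be an orthonormal family (which may depend on $N$) in a complex inner product space $\mathcal H_N$, and put $\mathcal X=\mathcal F_q(\mathcal H_N)$ and $\mathcal X_N=M_N(\mathcal X)$. For a matrix $[T_{i,j}]$ of linear operators on $\mathcal X$ define linear operators on $\mathcal X_N$ by $$L([T_{i,j}])[\eta_{i,j}]=\Big[\sum_{k}T_{i,k}(\eta_{k,j})\Big],\qquad R([T_{i,j}])[\eta_{i,j}]=\Big[\sum_{k}T_{k,j}(\eta_{i,k})\Big].$$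 For a linear operator $Z$ on $\mathcal X_N$ let $E(Z)\in M_N(\mathbb C)$ be obtained by applying $\eta\mapsto\langle\eta,\Omega_q\rangle_q$ to each entry of $Z\,\mathrm{diag}(\Omega_q,\dots,\Omega_q)$, and let $\Psi_N=\frac1N\mathrm{Tr}\circ E$. With $Z^\ell=L$, $Z^r=R$, $z^\ell=a$, $z^r=b$, define for $\theta\in\{\ell,r\}$ and $k\in K$ $$Z^{\theta,\cdot}_k(N)=\tfrac1{\sqrt N}Z^\theta\big([z^\theta(h^k_{i,j})]\big),\qquad Z^{\theta,*}_k(N)=\tfrac1{\sqrt N}Z^\theta\big([(z^\theta)^*(h^k_{j,i})]\big),$$ $$Z^{\theta,t}_k(N)=\tfrac1{\sqrt N}Z^\theta\big([z^\theta(h^k_{j,i})]\big),\qquad Z^{\theta,t*}_k(N)=\tfrac1{\sqrt N}Z^\theta\big([(z^\theta)^*(h^k_{i,j})]\big).$$ Let $\{h_k,h^t_k: k\in K\}$ be an orthonormal family in a complex inner product space $\mathcal H_0$ and, on the full Fock space $\mathcal F_0(\mathcal H_0)$, with $z_0^\ell=l$ and $z_0^r=r$, put $z^{\theta,\cdot}_k=z_0^\theta(h_k)$,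 $z^{\theta,*}_k=(z_0^\theta)^*(h_k)$, $z^{\theta,t}_k=z_0^\theta(h^t_k)$, $z^{\theta,t*}_k=(z_0^\theta)^*(h^t_k)$. **Theorem.** As $N\to\infty$, the joint distribution of $\{Z^{\theta,w}_k(N): k\in K,\ \theta\in\{\ell,r\},\ w\in\{\cdot,*,t,t*\}\}$ with respect to $\Psi_N$ converges to the joint distribution of $\{z^{\theta,w}_k\}$ with respect to $\varphi_0$; that is, for every noncommutative polynomial $P$ in variables indexed by $(k,\theta,w)$, $$\lim_{N\to\infty}\Psi_N\big(P(Z^{\theta,w}_k(N))\big)=\varphi_0\big(P(z^{\theta,w}_k)\big).$$ Moreover, for every fixed word $(k_1,\theta_1,w_1),\dots,(k_n,\theta_n,w_n)$, $$\Psi_N\big(Z^{\theta_1,w_1}_{k_1}(N)\cdots Z^{\theta_n,w_n}_{k_n}(N)\big)-\varphi_0\big(z^{\theta_1,w_1}_{k_1}\cdots z^{\theta_n,w_n}_{k_n}\big)=O\big(\tfrac1N\big)\quad\text{as }N\to\infty .$$ -/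

import Mathlib

open Filter Topology Asymptotics
open scoped TensorProduct DirectSum InnerProductSpace

noncomputable section

namespace QBiMatrix

/-- The label of a face: left or right. -/
inductive Side
  | left
  | right

/-- The four decorations `·`, `*`, `t`, `t*`. -/
inductive Deco
  | plain
  | adj
  | tr
  | trAdj

/-! ### The algebraic Fock space and the `q`-inner product -/

/-- The algebraic Fock space `ℂΩ ⊕ ⨁_{n ≥ 1} H^{⊗ n}`; the summand `n = 0` is spanned by the
empty tensor, the vacuum. -/
abbrev AlgFock (H : Type*) [NormedAddCommGroup H] [InnerProductSpace ℂ H] : Type _ :=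
  ⨁ n : ℕ, ⨂[ℂ]^n H

/-- The number of inversions of a permutation. -/
def inv {n : ℕ} (σ : Equiv.Perm (Fin n)) : ℕ :=
  (Finset.univ.filter fun p : Fin n × Fin n => p.1 < p.2 ∧ σ p.2 < σ p.1).card

section

variable {H : Type*} [NormedAddCommGroup H] [InnerProductSpace ℂ H]

/-- The elementary tensor `v₁ ⊗ ⋯ ⊗ vₙ` in the Fock space. -/
def elem {n : ℕ} (v : Fin n → H) : AlgFock H :=
  DirectSum.lof ℂ ℕ (fun n => ⨂[ℂ]^n H) n (PiTensorProduct.tprod ℂ v)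

/-- The vacuum vector, the empty tensor. -/
def algVacuum (H : Type*) [NormedAddCommGroup H] [InnerProductSpace ℂ H] : AlgFock H :=
  elem (Fin.elim0 : Fin 0 → H)

theorem algFock_induction {P : AlgFock H → Prop} (h0 : P 0)
    (he : ∀ (n : ℕ) (c : ℂ) (v : Fin n → H), P (c • elem v))
    (ha : ∀ x y, P x → P y → P (x + y)) (x : AlgFock H) : P x := by
  induction x using DirectSum.induction_on with
  | zero => exact h0
  | add x y hx hy => exact ha x y hx hy
  | of n z =>
    induction z using PiTensorProduct.induction_on with
    | smul_tprod r f =>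
      have := he n r f
      rwa [elem, ← map_smul] at this
    | add a b hxa hxb =>
      rw [map_add]
      exact ha _ _ hxa hxb

/-- The conjugate-linear map on `H^{⊗ n}` determined by a map on tuples that is additive and
conjugate-homogeneous in every variable. -/
def conjLift {n : ℕ} {F : Type*} [AddCommGroup F] [Module ℂ F] (φ : (Fin n → H) → F)
    (hadd : ∀ (f : Fin n → H) (i : Fin n) (a b : H),
      φ (Function.update f i (a + b)) = φ (Function.update f i a) + φ (Function.update f i b))
    (hsmul : ∀ (f : Fin n → H) (i : Fin n) (c : ℂ) (a : H),
      φ (Function.update f i (c • a)) = (starRingEnd ℂ) c • φ (Function.update f i a)) :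
    (⨂[ℂ]^n H) →ₗ⋆[ℂ] F :=
  { PiTensorProduct.liftAddHom (fun p : ℂ × (Fin n → H) => (starRingEnd ℂ) p.1 • φ p.2)
      (by
        intro r f i hf
        have h := hsmul f i 0 (f i)
        rw [zero_smul, map_zero, zero_smul, ← hf, Function.update_eq_self] at h
        simp only [h, smul_zero])
      (by intro f; simp)
      (by
        intro inst r f i a b
        have : inst = fun a b => instDecidableEqFin n a b := Subsingleton.elim _ _
        subst this
        simp only [← smul_add, ← hadd])
      (by intro r r' f; simp only [map_add, add_smul])
      (by
        intro inst r f i c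
        have : inst = fun a b => instDecidableEqFin n a b := Subsingleton.elim _ _
        subst this
        simp only [hsmul, Function.update_eq_self, smul_smul, map_mul, mul_comm]) with
    map_smul' := by
      intro c x
      induction x using PiTensorProduct.induction_on' with
      | tprodCoeff r f =>
        change (starRingEnd ℂ) (c * r) • φ f = (starRingEnd ℂ) c • ((starRingEnd ℂ) r • φ f)
        rw [map_mul, mul_smul]
      | add a b ha hb => 
        simp only [ZeroHom.toFun_eq_coe, AddMonoidHom.toZeroHom_coe] at ha hb ⊢
        rw [smul_add, map_add, map_add, ha, hb, smul_add] }

theorem conjLift_tprod {n : ℕ} {F : Type*} [AddCommGroup F] [Module ℂ F] (φ : (Fin n → H) → F)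
    (hadd hsmul) (f : Fin n → H) :
    conjLift φ hadd hsmul (PiTensorProduct.tprod ℂ f) = φ f := by
  rw [PiTensorProduct.tprod_eq_tprodCoeff_one]
  change (starRingEnd ℂ) (1 : ℂ) • φ f = φ f
  simp

/-- The linear functional `y₁ ⊗ ⋯ ⊗ yₙ ↦ ∏ₖ ⟪xₖ, yₖ⟫` on `H^{⊗ n}`. -/
def bra {n : ℕ} (x : Fin n → H) : (⨂[ℂ]^n H) →ₗ[ℂ] ℂ :=
  PiTensorProduct.lift
    ((MultilinearMap.mkPiAlgebra ℂ (Fin n) ℂ).compLinearMap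
      fun k => (innerSL ℂ (x k)).toLinearMap)

@[simp] theorem bra_tprod {n : ℕ} (x y : Fin n → H) :
    bra x (PiTensorProduct.tprod ℂ y) = ∏ k, ⟪x k, y k⟫_ℂ := by
  simp [bra]

theorem sum_update_aux {n : ℕ} (x y : Fin n → H) (i : Fin n) (a : H) :
    ∏ k, ⟪Function.update x i a k, y k⟫_ℂ
      = ⟪a, y i⟫_ℂ * ∏ k ∈ Finset.univ.erase i, ⟪x k, y k⟫_ℂ := by
  rw [← Finset.mul_prod_erase _ _ (Finset.mem_univ i), Function.update_self]
  congr 1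
  refine Finset.prod_congr rfl fun k hk => ?_
  rw [Function.update_of_ne (Finset.ne_of_mem_erase hk)]

theorem bra_update_add {n : ℕ} (x : Fin n → H) (i : Fin n) (a b : H) :
    bra (Function.update x i (a + b))
      = bra (Function.update x i a) + bra (Function.update x i b) := by
  refine PiTensorProduct.ext (MultilinearMap.ext fun y => ?_)
  simp [sum_update_aux, add_mul]

theorem bra_update_smul {n : ℕ} (x : Fin n → H) (i : Fin n) (c : ℂ) (a : H) :
    bra (Function.update x i (c • a))
      = (starRingEnd ℂ) c • bra (Function.update x i a) := by
  refine PiTensorProduct.ext (MultilinearMap.ext fun y => ?_)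
  simp [sum_update_aux]
  ring

/-- The `q`-inner product on `H^{⊗ n}` (conjugate-linear in the first variable):
`⟨h₁ ⊗ ⋯ ⊗ hₙ, g₁ ⊗ ⋯ ⊗ gₙ⟩_q = ∑_σ q ^ inv σ ∏ₖ ⟪h_{σ k}, gₖ⟫`. -/
def qFormN (q : ℝ) (n : ℕ) : (⨂[ℂ]^n H) →ₗ⋆[ℂ] (⨂[ℂ]^n H) →ₗ[ℂ] ℂ :=
  conjLift (fun x => ∑ σ : Equiv.Perm (Fin n), (q : ℂ) ^ inv σ • bra (x ∘ σ))
    (by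
      intro f i a b
      rw [← Finset.sum_add_distrib]
      refine Finset.sum_congr rfl fun σ _ => ?_
      rw [← smul_add]
      simp only [Function.update_comp_equiv]
      rw [bra_update_add])
    (by
      intro f i c a
      rw [Finset.smul_sum]
      refine Finset.sum_congr rfl fun σ _ => ?_
      rw [smul_comm]
      simp only [Function.update_comp_equiv]
      rw [bra_update_smul])

theorem qFormN_tprod (q : ℝ) {n : ℕ} (x y : Fin n → H) :
    qFormN q n (PiTensorProduct.tprod ℂ x) (PiTensorProduct.tprod ℂ y)
      = ∑ σ : Equiv.Perm (Fin n), (q : ℂ) ^ inv σ * ∏ k, ⟪x (σ k), y k⟫_ℂ := by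
  rw [qFormN, conjLift_tprod]
  simp

/-- The additive map underlying `qForm`. -/
def qFormAdd (q : ℝ) : AlgFock H →+ (AlgFock H →ₗ[ℂ] ℂ) :=
  DirectSum.toAddMonoid fun n =>
    { toFun := fun x => (qFormN q n x).comp (DirectSum.component ℂ ℕ (fun n => ⨂[ℂ]^n H) n)
      map_zero' := by simp
      map_add' := by intro a b; rw [map_add, LinearMap.add_comp] }

theorem qFormAdd_lof (q : ℝ) (n : ℕ) (z : ⨂[ℂ]^n H) :
    qFormAdd q (DirectSum.lof ℂ ℕ (fun n => ⨂[ℂ]^n H) n z)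
      = (qFormN q n z).comp (DirectSum.component ℂ ℕ (fun n => ⨂[ℂ]^n H) n) := by
  rw [DirectSum.lof_eq_of, qFormAdd, DirectSum.toAddMonoid_of]
  rfl

/-- The `q`-inner product on the algebraic Fock space: the orthogonal sum over all lengths of
tensors. Conjugate-linear in the first variable. -/
def qForm (q : ℝ) : AlgFock H →ₗ⋆[ℂ] AlgFock H →ₗ[ℂ] ℂ :=
  { qFormAdd q with
    map_smul' := by
      intro c x
      simp only [ZeroHom.toFun_eq_coe, AddMonoidHom.toZeroHom_coe]
      induction x using DirectSum.induction_on with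
      | zero => simp
      | of n z =>
        rw [← DirectSum.lof_eq_of ℂ, ← map_smul, qFormAdd_lof, qFormAdd_lof,
          LinearMap.map_smulₛₗ, LinearMap.smul_comp]
      | add a b ha hb => rw [smul_add, map_add, map_add, ha, hb, smul_add] }

theorem qForm_elem (q : ℝ) {n : ℕ} (x y : Fin n → H) :
    qForm q (elem x) (elem y)
      = ∑ σ : Equiv.Perm (Fin n), (q : ℂ) ^ inv σ * ∏ k, ⟪x (σ k), y k⟫_ℂ := by
  rw [← qFormN_tprod]
  change qFormAdd q (elem x) (elem y) = _
  rw [elem, elem, qFormAdd_lof, LinearMap.comp_apply, DirectSum.component.lof_self]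

theorem qForm_elem_of_ne (q : ℝ) {n m : ℕ} (hnm : n ≠ m) (x : Fin n → H) (y : Fin m → H) :
    qForm q (elem x) (elem y) = 0 := by
  change qFormAdd q (elem x) (elem y) = _
  rw [elem, elem, qFormAdd_lof, LinearMap.comp_apply, DirectSum.component.of,
    dif_neg (Ne.symm hnm), map_zero]

/-! ### Creation and annihilation operators on the algebraic Fock space -/

/-- Position at which a creation operator inserts its vector into a tensor of length `n`. -/
def pos : Side → (n : ℕ) → Fin (n + 1)
  | .left, _ => 0
  | .right, n => Fin.last n

/-- Weight with which an annihilation operator removes the `k`-th vector (counted from `0`) of a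
tensor of length `n + 1`. -/
def weight (q : ℝ) : Side → (n : ℕ) → Fin (n + 1) → ℂ
  | .left, _, k => (q : ℂ) ^ (k : ℕ)
  | .right, n, k => (q : ℂ) ^ (n - (k : ℕ))

/-- `a(h)` (left) and `b(h)` (right): insert `h` at the left, respectively right, end. -/
def algCreation (s : Side) (h : H) : Module.End ℂ (AlgFock H) :=
  DirectSum.toModule ℂ ℕ (AlgFock H) fun n =>
    (DirectSum.lof ℂ ℕ (fun n => ⨂[ℂ]^n H) (n + 1)).comp
      (PiTensorProduct.lift
        ((PiTensorProduct.tprod ℂ : MultilinearMap ℂ (fun _ : Fin (n + 1) => H) _).curryMid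
          (pos s n) h))

/-- `a*(h)` (left) and `b*(h)` (right): zero on the vacuum, and on a tensor of length `n + 1`
the sum over `k` of the weight of `k` times `⟪h, hₖ⟫` times the tensor with `hₖ` omitted. -/
def algAnnihilation (q : ℝ) (s : Side) (h : H) : Module.End ℂ (AlgFock H) :=
  DirectSum.toModule ℂ ℕ (AlgFock H) fun
    | 0 => 0
    | n + 1 =>
      (DirectSum.lof ℂ ℕ (fun n => ⨂[ℂ]^n H) n).comp
        (PiTensorProduct.lift
          (∑ k : Fin (n + 1), weight q s n k •
            LinearMap.uncurryMid k
              ((innerSL ℂ h).toLinearMap.smulRight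
                (PiTensorProduct.tprod ℂ : MultilinearMap ℂ (fun _ : Fin n => H) _))))

theorem algCreation_elem (s : Side) (h : H) {n : ℕ} (v : Fin n → H) :
    algCreation s h (elem v) = elem (Fin.insertNth (α := fun _ => H) (pos s n) h v) := by
  rw [elem, algCreation, DirectSum.toModule_lof]
  simp [elem]

theorem algCreation_left_elem (h : H) {n : ℕ} (v : Fin n → H) :
    algCreation .left h (elem v) = elem (Fin.cons h v : Fin (n + 1) → H) := by
  rw [algCreation_elem, pos, Fin.insertNth_zero']

theorem algCreation_right_elem (h : H) {n : ℕ} (v : Fin n → H) :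
    algCreation .right h (elem v) = elem (Fin.snoc v h : Fin (n + 1) → H) := by
  rw [algCreation_elem, pos, Fin.insertNth_last']

theorem algAnnihilation_vacuum (q : ℝ) (s : Side) (h : H) :
    algAnnihilation q s h (algVacuum H) = 0 := by
  rw [algVacuum, elem, algAnnihilation, DirectSum.toModule_lof]
  simp

theorem algAnnihilation_elem (q : ℝ) (s : Side) (h : H) {n : ℕ} (v : Fin (n + 1) → H) :
    algAnnihilation q s h (elem v)
      = ∑ k, (weight q s n k * ⟪h, v k⟫_ℂ) • elem (k.removeNth v) := by
  rw [elem, algAnnihilation, DirectSum.toModule_lof]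
  simp [elem, mul_smul]

end

/-! ### Annihilation is adjoint to creation -/

/-- The permutation sending `p` to `r` and acting as `σ` between the complements. -/
def insPerm {n : ℕ} (r p : Fin (n + 1)) (σ : Equiv.Perm (Fin n)) : Equiv.Perm (Fin (n + 1)) :=
  (finSuccEquiv' p).trans ((Equiv.optionCongr σ).trans (finSuccEquiv' r).symm)

@[simp] theorem insPerm_self {n : ℕ} (r p : Fin (n + 1)) (σ : Equiv.Perm (Fin n)) :
    insPerm r p σ p = r := by
  simp [insPerm]

@[simp] theorem insPerm_succAbove {n : ℕ} (r p : Fin (n + 1)) (σ : Equiv.Perm (Fin n))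
    (k : Fin n) : insPerm r p σ (p.succAbove k) = r.succAbove (σ k) := by
  simp [insPerm]

theorem insPerm_bijective {n : ℕ} (r : Fin (n + 1)) :
    Function.Bijective fun x : Fin (n + 1) × Equiv.Perm (Fin n) => insPerm r x.1 x.2 := by
  rw [Fintype.bijective_iff_injective_and_card]
  constructor
  · rintro ⟨p, σ⟩ ⟨p', σ'⟩ h
    simp only at h
    have hp : p = p' := by
      apply (insPerm r p' σ').injective
      rw [insPerm_self, ← h, insPerm_self]
    subst hp
    congr
    ext k
    have := congrArg (fun τ : Equiv.Perm (Fin (n + 1)) => τ (p.succAbove k)) h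
    simp only [insPerm_succAbove] at this
    rw [Fin.succAbove_right_injective this]
  · simp [Fintype.card_perm, Nat.factorial_succ]

theorem sum_insPerm {n : ℕ} (r : Fin (n + 1)) (F : Equiv.Perm (Fin (n + 1)) → ℂ) :
    ∑ τ, F τ = ∑ p, ∑ σ, F (insPerm r p σ) := by
  rw [← Fintype.sum_prod_type']
  exact ((insPerm_bijective r).sum_comp F).symm

theorem inv_eq_sum {n : ℕ} (σ : Equiv.Perm (Fin n)) :
    inv σ = ∑ i, ∑ j, if i < j ∧ σ j < σ i then 1 else 0 := by
  rw [inv, Finset.card_filter, Fintype.sum_prod_type]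

theorem inv_symm {n : ℕ} (σ : Equiv.Perm (Fin n)) : inv σ.symm = inv σ := by
  rw [inv_eq_sum, inv_eq_sum, Finset.sum_comm, ← Equiv.sum_comp σ]
  refine Finset.sum_congr rfl fun i _ => ?_
  rw [← Equiv.sum_comp σ]
  simp [and_comm]

theorem inv_insPerm {n : ℕ} (r p : Fin (n + 1)) (σ : Equiv.Perm (Fin n)) :
    inv (insPerm r p σ)
      = (∑ k, if p < p.succAbove k ∧ r.succAbove (σ k) < r then 1 else 0)
        + (∑ k, if p.succAbove k < p ∧ r < r.succAbove (σ k) then 1 else 0) + inv σ := by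
  rw [inv_eq_sum, Fin.sum_univ_succAbove _ p, Fin.sum_univ_succAbove _ p]
  simp_rw [Fin.sum_univ_succAbove _ p]
  rw [Finset.sum_add_distrib, inv_eq_sum]
  simp [add_assoc, Fin.succAbove_lt_succAbove_iff]

theorem card_lt_aux {n : ℕ} (p : Fin (n + 1)) :
    (∑ k : Fin n, if p.succAbove k < p then 1 else 0) = (p : ℕ) := by
  have h : ∑ k : Fin (n + 1), (if k < p then 1 else 0) = (p : ℕ) := by
    rw [← Finset.card_filter, Finset.filter_gt_eq_Iio, Fin.card_Iio]
  rw [Fin.sum_univ_succAbove _ p] at h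
  simpa using h

theorem card_gt_aux {n : ℕ} (p : Fin (n + 1)) :
    (∑ k : Fin n, if p < p.succAbove k then 1 else 0) = n - (p : ℕ) := by
  have h : ∑ k : Fin (n + 1), (if p < k then 1 else 0) = n - (p : ℕ) := by
    rw [← Finset.card_filter, Finset.filter_lt_eq_Ioi, Fin.card_Ioi]
    omega
  rw [Fin.sum_univ_succAbove _ p] at h
  simpa using h

theorem inv_insPerm_pos {n : ℕ} (q : ℝ) (s : Side) (p : Fin (n + 1)) (σ : Equiv.Perm (Fin n)) :
    (q : ℂ) ^ inv (insPerm (pos s n) p σ) = weight q s n p * (q : ℂ) ^ inv σ := by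
  rw [inv_insPerm, pow_add]
  congr 1
  cases s with
  | left => simp [pos, weight, Fin.succ_pos, -Finset.sum_boole, card_lt_aux]
  | right => simp [pos, weight, Fin.castSucc_lt_last, -Finset.sum_boole, card_gt_aux,
      not_lt.2 (Fin.le_last _)]

section

variable {H : Type*} [NormedAddCommGroup H] [InnerProductSpace ℂ H]

theorem qForm_symm (q : ℝ) (x y : AlgFock H) :
    (starRingEnd ℂ) (qForm q x y) = qForm q y x := by
  induction x using algFock_induction with
  | h0 => simp
  | ha a b ha hb => simp only [map_add, LinearMap.add_apply, ha, hb]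
  | he n c v =>
    induction y using algFock_induction with
    | h0 => simp
    | ha a b ha hb => simp only [map_add, LinearMap.add_apply, ha, hb]
    | he m d w =>
      simp only [map_smul, LinearMap.map_smulₛₗ, LinearMap.smul_apply, smul_eq_mul, map_mul,
        Complex.conj_conj]
      rw [mul_left_comm]
      congr 2
      by_cases hnm : n = m
      · subst hnm
        rw [qForm_elem, qForm_elem, map_sum, ← Equiv.sum_comp (Equiv.inv _)]
        refine Finset.sum_congr rfl fun σ _ => ?_
        simp only [Equiv.inv_apply, map_mul, map_pow, Complex.conj_ofReal, map_prod,
          inner_conj_symm]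
        rw [show σ⁻¹ = σ.symm from rfl, inv_symm, ← Equiv.prod_comp σ]
        simp
      · rw [qForm_elem_of_ne q hnm, qForm_elem_of_ne q (Ne.symm hnm), map_zero]

/-- `a*(h)` is the adjoint of `a(h)`, and `b*(h)` that of `b(h)`, for the `q`-inner product. -/
theorem qForm_creation_left (q : ℝ) (s : Side) (h : H) (x y : AlgFock H) :
    qForm q (algCreation s h x) y = qForm q x (algAnnihilation q s h y) := by
  induction x using algFock_induction with
  | h0 => simp
  | ha a b ha hb => simp only [map_add, LinearMap.add_apply, ha, hb]
  | he n c v =>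
    simp only [map_smul, LinearMap.map_smulₛₗ, LinearMap.smul_apply]
    congr 1
    induction y using algFock_induction with
    | h0 => simp
    | ha a b ha hb => simp only [map_add, ha, hb]
    | he m d w =>
      simp only [map_smul]
      congr 1
      rw [algCreation_elem]
      cases m with
      | zero =>
        have hw : elem w = algVacuum H := by
          rw [algVacuum]; congr 1; exact Subsingleton.elim _ _
        rw [qForm_elem_of_ne q (Nat.succ_ne_zero n), hw, algAnnihilation_vacuum, map_zero]
      | succ m =>
        rw [algAnnihilation_elem, map_sum]
        simp only [map_smul, smul_eq_mul]
        by_cases hnm : n = m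
        · subst hnm
          rw [qForm_elem, sum_insPerm (pos s n)]
          refine Finset.sum_congr rfl fun p _ => ?_
          rw [qForm_elem, Finset.mul_sum]
          refine Finset.sum_congr rfl fun σ _ => ?_
          rw [inv_insPerm_pos, Fin.prod_univ_succAbove _ p]
          simp only [insPerm_self, insPerm_succAbove, Fin.insertNth_apply_same,
            Fin.insertNth_apply_succAbove, Fin.removeNth]
          ring
        · rw [qForm_elem_of_ne q (by omega)]
          refine (Finset.sum_eq_zero fun p _ => ?_).symm
          rw [qForm_elem_of_ne q hnm, mul_zero]

theorem qForm_creation_right (q : ℝ) (s : Side) (h : H) (x y : AlgFock H) :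
    qForm q x (algCreation s h y) = qForm q (algAnnihilation q s h x) y := by
  rw [← qForm_symm, qForm_creation_left, qForm_symm]

/-! ### The `q`-deformed Fock space and its operators -/

/-- The radical of the `q`-inner product. -/
def radical (q : ℝ) (H : Type*) [NormedAddCommGroup H] [InnerProductSpace ℂ H] :
    Submodule ℂ (AlgFock H) where
  carrier := {y | ∀ x, qForm q x y = 0}
  zero_mem' := by intro x; simp
  add_mem' := by
    intro a b ha hb x
    rw [map_add, ha x, hb x, add_zero]
  smul_mem' := by
    intro c a ha x
    rw [map_smul, ha x, smul_zero]

/-- The `q`-deformed Fock space, as the pre-Hilbert space of finite sums of tensors: the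
algebraic Fock space with the `q`-inner product, modulo the vectors orthogonal to everything.
(That radical is zero for `|q| < 1`; for `q = 1`, `q = -1` the quotient is the symmetric,
respectively antisymmetric, Fock space.) The space is not completed, because for `q = 1` the
creation and annihilation operators are unbounded and have this dense subspace as their common
invariant domain. -/
abbrev QFock (q : ℝ) (H : Type*) [NormedAddCommGroup H] [InnerProductSpace ℂ H] : Type _ :=
  AlgFock H ⧸ radical q H

/-- The vacuum vector `Ω_q`. -/
def vacuum (q : ℝ) (H : Type*) [NormedAddCommGroup H] [InnerProductSpace ℂ H] : QFock q H :=
  (radical q H).mkQ (algVacuum H)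

/-- The `q`-inner product on the `q`-deformed Fock space. -/
def qInner (q : ℝ) : QFock q H →ₗ⋆[ℂ] QFock q H →ₗ[ℂ] ℂ :=
  (radical q H).liftQ
    { toFun := fun x => (radical q H).liftQ (qForm q x) fun _ hy => hy x
      map_add' := by
        intro a b
        refine Submodule.linearMap_qext _ (LinearMap.ext fun y => ?_)
        change qForm q (a + b) y = qForm q a y + qForm q b y
        rw [map_add, LinearMap.add_apply]
      map_smul' := by
        intro c a
        refine Submodule.linearMap_qext _ (LinearMap.ext fun y => ?_)
        change qForm q (c • a) y = (starRingEnd ℂ) c • qForm q a y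
        rw [LinearMap.map_smulₛₗ, LinearMap.smul_apply] }
    (by
      intro x hx
      refine Submodule.linearMap_qext _ (LinearMap.ext fun y => ?_)
      change qForm q x y = 0
      rw [← qForm_symm, hx y, map_zero])

theorem qInner_mkQ (q : ℝ) (x y : AlgFock H) :
    qInner (H := H) q ((radical q H).mkQ x) ((radical q H).mkQ y) = qForm q x y := rfl

/-- The creation operators `a(h)` (left) and `b(h)` (right) on the `q`-deformed Fock space. -/
def creation (q : ℝ) (s : Side) (h : H) : Module.End ℂ (QFock q H) :=
  (radical q H).mapQ (radical q H) (algCreation s h) fun y hy x => by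
    rw [qForm_creation_right]; exact hy _

/-- The annihilation operators `a*(h)` (left) and `b*(h)` (right) on the `q`-deformed Fock
space. -/
def annihilation (q : ℝ) (s : Side) (h : H) : Module.End ℂ (QFock q H) :=
  (radical q H).mapQ (radical q H) (algAnnihilation q s h) fun y hy x => by
    rw [← qForm_creation_left]; exact hy _

theorem creation_mkQ (q : ℝ) (s : Side) (h : H) (x : AlgFock H) :
    creation q s h ((radical q H).mkQ x) = (radical q H).mkQ (algCreation s h x) := rfl

theorem annihilation_mkQ (q : ℝ) (s : Side) (h : H) (x : AlgFock H) :
    annihilation q s h ((radical q H).mkQ x) = (radical q H).mkQ (algAnnihilation q s h x) := rfl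

/-- The projection `η ↦ ⟨η, Ω_q⟩_q` onto the vacuum component. -/
def vacuumCoeff (q : ℝ) (H : Type*) [NormedAddCommGroup H] [InnerProductSpace ℂ H] :
    QFock q H →ₗ[ℂ] ℂ :=
  qInner (H := H) q (vacuum q H)

/-- The vacuum state `φ_q(T) = ⟨T Ω_q, Ω_q⟩_q`. -/
def vacuumState (q : ℝ) (H : Type*) [NormedAddCommGroup H] [InnerProductSpace ℂ H] :
    Module.End ℂ (QFock q H) →ₗ[ℂ] ℂ :=
  (vacuumCoeff q H).comp (LinearMap.applyₗ (vacuum q H))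

end

/-! ### Left and right matrices over a pointed vector space -/

section

variable {X : Type*} [AddCommGroup X] [Module ℂ X] {N : ℕ}

/-- The left matrix `L([T_{ij}])` acting on `M_N(X)` by `[η_{ij}] ↦ [∑ₖ T_{ik} η_{kj}]`. -/
def leftMatrix (T : Matrix (Fin N) (Fin N) (Module.End ℂ X)) :
    Module.End ℂ (Matrix (Fin N) (Fin N) X) where
  toFun η := Matrix.of fun i j => ∑ k, T i k (η k j)
  map_add' η ζ := by ext i j; simp [Finset.sum_add_distrib]
  map_smul' c η := by ext i j; simp [Finset.smul_sum]

/-- The right matrix `R([S_{ij}])` acting on `M_N(X)` by `[η_{ij}] ↦ [∑ₖ S_{kj} η_{ik}]`. -/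
def rightMatrix (S : Matrix (Fin N) (Fin N) (Module.End ℂ X)) :
    Module.End ℂ (Matrix (Fin N) (Fin N) X) where
  toFun η := Matrix.of fun i j => ∑ k, S k j (η i k)
  map_add' η ζ := by ext i j; simp [Finset.sum_add_distrib]
  map_smul' c η := by ext i j; simp [Finset.smul_sum]

/-- The left or right matrix with given entries. -/
def faceMatrix : Side → Matrix (Fin N) (Fin N) (Module.End ℂ X) →
    Module.End ℂ (Matrix (Fin N) (Fin N) X)
  | .left => leftMatrix
  | .right => rightMatrix

/-- The expectation `E(Z) = p(Z I_{N,ξ})` of operators on `M_N(X)` onto `M_N(ℂ)`, where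
`I_{N,ξ} = diag(ξ, …, ξ)` and the functional `p` on `X` is applied entrywise. -/
def matrixExpectation (N : ℕ) (ξ : X) (p : X →ₗ[ℂ] ℂ) :
    Module.End ℂ (Matrix (Fin N) (Fin N) X) →ₗ[ℂ] Matrix (Fin N) (Fin N) ℂ :=
  (p.mapMatrix).comp (LinearMap.applyₗ (Matrix.diagonal fun _ => ξ))

end

section

variable {H : Type*} [NormedAddCommGroup H] [InnerProductSpace ℂ H]

/-- The state `Ψ_N = (1/N) Tr ∘ E` on operators on `M_N(F_q(H))`. -/
def traceState (q : ℝ) (H : Type*) [NormedAddCommGroup H] [InnerProductSpace ℂ H] (N : ℕ) :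
    Module.End ℂ (Matrix (Fin N) (Fin N) (QFock q H)) →ₗ[ℂ] ℂ :=
  ((N : ℂ)⁻¹) • (Matrix.traceLinearMap (Fin N) ℂ ℂ).comp
    (matrixExpectation N (vacuum q H) (vacuumCoeff q H))

/-- The four kinds of `N × N` matrix of operators built from vectors `h i j`, before they are made
to act from the left or right: `[z(h_{ij})]`, `[z*(h_{ji})]`, `[z(h_{ji})]`, `[z*(h_{ij})]`, where
`z = a` for the left and `z = b` for the right side. -/
def entries (q : ℝ) (s : Side) {N : ℕ} (h : Fin N → Fin N → H) :
    Deco → Matrix (Fin N) (Fin N) (Module.End ℂ (QFock q H))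
  | .plain => Matrix.of fun i j => creation q s (h i j)
  | .adj => Matrix.of fun i j => annihilation q s (h j i)
  | .tr => Matrix.of fun i j => creation q s (h j i)
  | .trAdj => Matrix.of fun i j => annihilation q s (h i j)

/-- The operators `Z^{θ,w}_k(N)`, indexed by `(k, θ, w)`. -/
def bimatrix (q : ℝ) {K : Type*} (N : ℕ) (h : K → Fin N → Fin N → H) :
    K × Side × Deco → Module.End ℂ (Matrix (Fin N) (Fin N) (QFock q H))
  | (k, θ, w) => (((Real.sqrt N)⁻¹ : ℝ) : ℂ) • faceMatrix θ (entries q θ (h k) w)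

/-- The left and right creation and annihilation operators `z^{θ,w}_k` of the vectors `h k`, `ht k`
on the full Fock space (the case `q = 0`), indexed by `(k, θ, w)`. -/
def limitOperators {K : Type*} (h ht : K → H) :
    K × Side × Deco → Module.End ℂ (QFock 0 H)
  | (k, θ, .plain) => creation 0 θ (h k)
  | (k, θ, .adj) => annihilation 0 θ (h k)
  | (k, θ, .tr) => creation 0 θ (ht k)
  | (k, θ, .trAdj) => annihilation 0 θ (ht k)

end

/-! ### Joint distributions -/

/-- The joint distribution of a family `Z` in a noncommutative probability space `(A, φ)`: the
functional `P ↦ φ(P(Z))` on noncommutative polynomials. -/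
def jointDistribution {A ι : Type*} [Ring A] [Algebra ℂ A] (φ : A →ₗ[ℂ] ℂ) (Z : ι → A) :
    FreeAlgebra ℂ ι →ₗ[ℂ] ℂ :=
  φ.comp (FreeAlgebra.lift ℂ Z).toLinearMap

/-- The noncommutative monomial of a word. -/
def wordMonomial {ι : Type*} (w : List ι) : FreeAlgebra ℂ ι :=
  (w.map (FreeAlgebra.ι ℂ)).prod

end QBiMatrix

end

namespace QBiMatrix

noncomputable section

/-! ### Coefficients of Fock space vectors along an orthonormal family -/

section

variable {H : Type*} [NormedAddCommGroup H] [InnerProductSpace ℂ H]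

/-! The proof is an `ℓ²` perturbation argument on coefficients, not a count of pairings. A Fock
space vector is replaced by its coefficients along the orthonormal family, taken with the full Fock
inner product for every `q`. Creation then adds a letter at one end of a word, annihilation sums
over all positions with weights `q ^ m`, and the vacuum coefficient does not depend on `q`
(`qForm_algVacuum`). Right operators are left operators conjugated by `reflect`, which reverses
words and transposes matrices.

For labels `c₁, …, cₙ`, the `(i, j)` entry of `path N [c₁, …, cₙ]` is `N ^ (-n/2)` times the sum,
over index sequences from `i` to `j`, of the words whose `r`-th letter is the entry of matrix `c_r`
at the `r`-th step. These matrices play the role of the basis tensors of the limiting full Fock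
space. Creation extends a path exactly. Annihilation of the end letter with matching label has a
free index whose `N` values cancel the normalization, which shortens the path exactly. A transposed
label or an interior letter forces an index coincidence, so those terms are small: with `energy` the
squared `ℓ²` norm over all entries, a path has energy at most `N` and each such term at most `1/N`
(`leftRemove_zero_path_cons`, `energy_leftRemove_succ_path_le`).

On words of bounded length every operator has energy norm bounded uniformly in `N`
(`energy_sideAct_le`), so the errors of a fixed product add up to energy `O(1/N)`
(`exists_energy_evolve_sub_le`). The normalized trace gains another `1/N` in square
(`enorm_traceCoeff_sq_le`), which gives the rate `O(1/N)`. Polynomials follow by linearity. -/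

/-- The elementary tensor of a list of vectors. -/
def listTensor (l : List H) : AlgFock H := elem l.get

theorem elem_eq_listTensor {n : ℕ} (v : Fin n → H) : elem v = listTensor (List.ofFn v) := by
  -- The length of `List.ofFn v` equals `n` only propositionally, so the length is generalized
  -- before substitution.
  have key : ∀ (m : ℕ) (w : Fin m → H) (hnm : n = m), (∀ i, v i = w (Fin.cast hnm i)) →
      elem v = elem w := by
    rintro m w rfl hw
    congr 1
    exact funext hw
  exact key _ _ (List.length_ofFn).symm fun i => by simp

theorem ofFn_insertNth {α : Type*} {n : ℕ} (k : Fin (n + 1)) (x : α) (v : Fin n → α) :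
    List.ofFn (Fin.insertNth (α := fun _ => α) k x v) = (List.ofFn v).insertIdx k x := by
  induction n with
  | zero =>
    obtain rfl : k = 0 := Fin.fin_one_eq_zero k
    simp
  | succ n ih =>
    induction k using Fin.cases with
    | zero => simp [List.ofFn_succ]
    | succ k =>
      obtain ⟨a, v, rfl⟩ : ∃ a v', v = Fin.cons (α := fun _ => α) a v' :=
        ⟨v 0, Fin.tail v, (Fin.cons_self_tail v).symm⟩
      rw [Fin.insertNth_succ_cons, List.ofFn_succ]
      simp only [Fin.cons_zero, Fin.cons_succ, ih, List.ofFn_succ (f := Fin.cons a v),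
        Fin.val_succ, List.insertIdx_succ_cons]

theorem listTensor_nil : listTensor ([] : List H) = algVacuum H := by
  rw [algVacuum, elem_eq_listTensor]; simp

/-- Without inversions `σ` is an order automorphism of a finite chain. Hence at `q = 0`, where `0 ^
0 = 1`, only the identity contributes to the inner product. -/
theorem eq_one_of_inv_eq_zero {n : ℕ} (σ : Equiv.Perm (Fin n)) (h : inv σ = 0) : σ = 1 := by
  have hmono : StrictMono σ := by
    intro i j hij
    by_contra hlt
    have hne : σ j ≠ σ i := fun hs => hij.ne' (σ.injective hs)
    rw [inv, Finset.card_eq_zero, Finset.filter_eq_empty_iff] at h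
    exact h (Finset.mem_univ (i, j)) ⟨hij, lt_of_le_of_ne (not_lt.1 hlt) hne⟩
  ext i
  have : (hmono.orderIsoOfSurjective σ σ.surjective) = OrderIso.refl (Fin n) :=
    Subsingleton.elim _ _
  have h2 := congrArg (fun f : Fin n ≃o Fin n => f i) this
  simp only [StrictMono.coe_orderIsoOfSurjective, OrderIso.refl_apply] at h2
  simp [h2]

theorem qForm_zero_elem {n : ℕ} (x y : Fin n → H) :
    qForm 0 (elem x) (elem y) = ∏ k, ⟪x k, y k⟫_ℂ := by
  rw [qForm_elem, Finset.sum_eq_single 1]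
  · have : inv (1 : Equiv.Perm (Fin n)) = 0 := by
      rw [inv, Finset.card_eq_zero, Finset.filter_eq_empty_iff]
      rintro ⟨i, j⟩ - ⟨h1, h2⟩
      exact lt_asymm h1 h2
    simp [this]
  · intro σ _ hσ
    have : inv σ ≠ 0 := fun h => hσ (eq_one_of_inv_eq_zero σ h)
    simp [this]
  · simp

/-- The vacuum pairs only with length zero, where the symmetric group is trivial. Moments can
therefore be read off with the full Fock inner product. -/
theorem qForm_algVacuum (q : ℝ) (y : AlgFock H) :
    qForm q (algVacuum H) y = qForm 0 (algVacuum H) y := by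
  induction y using algFock_induction with
  | h0 => simp
  | ha a b ha hb => simp only [map_add, ha, hb]
  | he n c v =>
    simp only [map_smul]
    rw [algVacuum]
    cases n with
    | zero => rw [qForm_elem, qForm_elem]; simp [inv]
    | succ n => rw [qForm_elem_of_ne q (by omega), qForm_elem_of_ne 0 (by omega)]

/-- For the full Fock product, omitting the `k`-th factor against `h` is adjoint to inserting `h` at
position `k`. The parameter `q` survives only in the weights. -/
theorem qForm_zero_annihilation (q : ℝ) (s : Side) (h : H) {n : ℕ} (x : Fin n → H)
    (y : AlgFock H) :
    qForm 0 (elem x) (algAnnihilation q s h y)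
      = ∑ k : Fin (n + 1), weight q s n k *
          qForm 0 (elem (Fin.insertNth (α := fun _ => H) k h x)) y := by
  induction y using algFock_induction with
  | h0 => simp
  | ha a b ha hb => simp only [map_add, ha, hb, mul_add, Finset.sum_add_distrib]
  | he m c v =>
    simp only [map_smul, smul_eq_mul, mul_left_comm _ c, ← Finset.mul_sum]
    congr 1
    cases m with
    | zero =>
      have hv : elem v = algVacuum H := by
        rw [algVacuum]; congr 1; exact Subsingleton.elim _ _
      rw [hv, algAnnihilation_vacuum, map_zero]
      refine (Finset.sum_eq_zero fun k _ => ?_).symm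
      rw [algVacuum, qForm_elem_of_ne 0 (by omega), mul_zero]
    | succ m =>
      rw [algAnnihilation_elem, map_sum]
      by_cases hnm : n = m
      · subst hnm
        refine Finset.sum_congr rfl fun k _ => ?_
        rw [map_smul, qForm_zero_elem, qForm_zero_elem, Fin.prod_univ_succAbove _ k]
        simp [Fin.removeNth, mul_assoc]
      · trans 0
        · refine Finset.sum_eq_zero fun k _ => ?_
          rw [map_smul, qForm_elem_of_ne 0 hnm, smul_zero]
        · refine (Finset.sum_eq_zero fun k _ => ?_).symm
          rw [qForm_elem_of_ne 0 (by omega), mul_zero]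

variable {X : Type*}

/-- The function on words whose value at `w` is the coefficient of the tensor `g w₁ ⊗ ⋯ ⊗ g wₙ`,
computed with the inner product of the full Fock space. -/
def coeff (g : X → H) (η : AlgFock H) (w : List X) : ℂ := qForm 0 (listTensor (w.map g)) η

theorem coeff_smul (g : X → H) (c : ℂ) (η : AlgFock H) : coeff g (c • η) = c • coeff g η := by
  ext w; simp [coeff]

theorem coeff_zero (g : X → H) : coeff g (0 : AlgFock H) = 0 := by
  ext w; simp [coeff]

theorem coeff_sum {ι : Type*} (s : Finset ι) (g : X → H) (η : ι → AlgFock H) :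
    coeff g (∑ i ∈ s, η i) = ∑ i ∈ s, coeff g (η i) := by
  ext w; simp [coeff]

end

/-! ### Creation and annihilation on functions of words -/

section

variable {X : Type*}

open Classical in
/-- Left creation of the letter `x`, on functions of words. -/
def wordCreation (x : X) (f : List X → ℂ) : List X → ℂ
  | [] => 0
  | y :: w => if y = x then f w else 0

/-- Left annihilation of the letter `x`, on functions of words. -/
def wordAnnihilation (q : ℝ) (x : X) (f : List X → ℂ) (w : List X) : ℂ :=
  ∑ m ∈ Finset.range (w.length + 1), (q : ℂ) ^ m * f (w.insertIdx m x)

/-- Reversal of words, on functions of words. -/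
def wordReverse (f : List X → ℂ) (w : List X) : ℂ := f w.reverse

@[simp] theorem wordReverse_wordReverse (f : List X → ℂ) : wordReverse (wordReverse f) = f := by
  ext w; simp [wordReverse]

theorem insertIdx_append_of_le (v w : List X) (x : X) (m : ℕ) (hm : m ≤ v.length) :
    (v ++ w).insertIdx m x = v.insertIdx m x ++ w := by
  induction v generalizing m with
  | nil =>
    obtain rfl : m = 0 := by simpa using hm
    simp
  | cons y v ih =>
    cases m with
    | zero => simp
    | succ m => simp [ih m (by simpa using hm)]

theorem insertIdx_reverse (w : List X) (x : X) (m : ℕ) (hm : m ≤ w.length) :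
    (w.reverse.insertIdx m x).reverse = w.insertIdx (w.length - m) x := by
  induction w generalizing m with
  | nil =>
    obtain rfl : m = 0 := by simpa using hm
    simp
  | cons y w ih =>
    rcases Nat.eq_or_lt_of_le hm with rfl | hlt
    · have : (y :: w).length = (y :: w).reverse.length := by simp
      rw [Nat.sub_self, this, List.insertIdx_length_self]
      simp
    · have hm' : m ≤ w.length := by simpa using Nat.le_of_lt_succ hlt
      rw [List.length_cons, Nat.succ_sub hm', List.insertIdx_succ_cons, ← ih m hm',
        List.reverse_cons, insertIdx_append_of_le]
      · simp
      · simpa using hm'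

/-- Reversal exchanges positions `m` and `w.length - m`, which turns the left weights into the right
ones. Here `w` is the word after removal, one letter shorter than the argument of `f`. -/
theorem wordReverse_wordAnnihilation (q : ℝ) (x : X) (f : List X → ℂ) (w : List X) :
    wordReverse (wordAnnihilation q x (wordReverse f)) w
      = ∑ m ∈ Finset.range (w.length + 1), (q : ℂ) ^ (w.length - m) * f (w.insertIdx m x) := by
  rw [wordReverse, wordAnnihilation, List.length_reverse, ← Finset.sum_range_reflect]
  refine Finset.sum_congr rfl fun m hm => ?_
  have hm' : m ≤ w.length := Nat.lt_succ_iff.1 (Finset.mem_range.1 hm)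
  rw [wordReverse, insertIdx_reverse _ _ _ (by omega)]
  congr 3; omega

end

/-! ### Fock space operators in coordinates -/

section

variable {H : Type*} [NormedAddCommGroup H] [InnerProductSpace ℂ H] {X : Type*}

theorem listTensor_insertIdx (l : List H) (h : H) (k : Fin (l.length + 1)) :
    elem (Fin.insertNth (α := fun _ => H) k h l.get) = listTensor (l.insertIdx k h) := by
  rw [elem_eq_listTensor, ofFn_insertNth, List.ofFn_get]

theorem coeff_annihilation_left (q : ℝ) (g : X → H) (x : X) (η : AlgFock H) :
    coeff g (algAnnihilation q .left (g x) η) = wordAnnihilation q x (coeff g η) := by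
  ext w
  rw [coeff, listTensor, qForm_zero_annihilation, wordAnnihilation]
  simp only [listTensor_insertIdx, weight, coeff, List.map_insertIdx]
  rw [Fin.sum_univ_eq_sum_range fun k => (q : ℂ) ^ k *
    qForm 0 (listTensor ((w.map g).insertIdx k (g x))) η, List.length_map]

theorem coeff_annihilation_right (q : ℝ) (g : X → H) (x : X) (η : AlgFock H) :
    coeff g (algAnnihilation q .right (g x) η)
      = wordReverse (wordAnnihilation q x (wordReverse (coeff g η))) := by
  ext w
  rw [coeff, listTensor, qForm_zero_annihilation, wordReverse_wordAnnihilation]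
  simp only [listTensor_insertIdx, weight, coeff, List.map_insertIdx]
  rw [Fin.sum_univ_eq_sum_range fun k => (q : ℂ) ^ ((w.map g).length - k) *
    qForm 0 (listTensor ((w.map g).insertIdx k (g x))) η, List.length_map]

/-- Creation does not involve `q`, so its adjoint may be taken at `q = 0`. There the weight `0 ^ k`
keeps only the first letter, and orthonormality turns the inner product into a Kronecker delta. -/
theorem coeff_creation_left {g : X → H} (hg : Orthonormal ℂ g) (x : X) (η : AlgFock H) :
    coeff g (algCreation .left (g x) η) = wordCreation x (coeff g η) := by
  classical
  ext w
  rw [coeff, qForm_creation_right]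
  cases w with
  | nil => rw [List.map_nil, listTensor_nil, algAnnihilation_vacuum]; simp [wordCreation]
  | cons y w =>
    have h1 : listTensor ((y :: w).map g)
        = elem (Fin.cons (g y) (w.map g).get : Fin ((w.map g).length + 1) → H) := by
      rw [elem_eq_listTensor, List.ofFn_cons, List.ofFn_get, List.map_cons]
    rw [h1, algAnnihilation_elem, Finset.sum_eq_single 0]
    · simp only [weight, Fin.val_zero, pow_zero, one_mul, Fin.cons_zero, wordCreation]
      rw [orthonormal_iff_ite.1 hg]
      by_cases h : y = x
      · subst h
        simp [coeff, listTensor]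
      · simp [h, Ne.symm h]
    · intro k _ hk
      have : (k : ℕ) ≠ 0 := fun h => hk (Fin.ext h)
      simp [weight, this]
    · simp

theorem coeff_creation_right {g : X → H} (hg : Orthonormal ℂ g) (x : X) (η : AlgFock H) :
    coeff g (algCreation .right (g x) η) = wordReverse (wordCreation x (wordReverse (coeff g η))) := by
  classical
  ext w
  rw [coeff, qForm_creation_right]
  rcases List.eq_nil_or_concat' w with rfl | ⟨w, y, rfl⟩
  · rw [List.map_nil, listTensor_nil, algAnnihilation_vacuum]; simp [wordCreation, wordReverse]
  · have h1 : listTensor ((w ++ [y]).map g)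
        = elem (Fin.snoc (w.map g).get (g y) : Fin ((w.map g).length + 1) → H) := by
      rw [elem_eq_listTensor, List.ofFn_succ']
      simp
    rw [h1, algAnnihilation_elem, Finset.sum_eq_single (Fin.last _)]
    · simp only [weight, Fin.val_last, Nat.sub_self, pow_zero, one_mul, Fin.snoc_last,
        wordReverse, List.reverse_append, List.reverse_cons, List.reverse_nil, List.nil_append,
        List.singleton_append, wordCreation, List.reverse_reverse]
      rw [orthonormal_iff_ite.1 hg]
      by_cases h : y = x
      · subst h
        simp [coeff, listTensor, Fin.init_snoc, Fin.removeNth_last]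
      · simp [h, Ne.symm h]
    · intro k _ hk
      have : (w.map g).length - (k : ℕ) ≠ 0 := by
        have := Fin.val_lt_last hk
        omega
      simp only [weight, Complex.ofReal_zero, zero_pow this, zero_mul, zero_smul]
    · simp

theorem coeff_algVacuum (g : X → H) (w : List X) [Decidable (w = [])] :
    coeff g (algVacuum H) w = if w = [] then 1 else 0 := by
  rw [coeff]
  cases w with
  | nil => rw [List.map_nil, listTensor_nil, algVacuum, qForm_zero_elem]; simp
  | cons y w => rw [listTensor, algVacuum, qForm_elem_of_ne 0 (by simp)]; simp

theorem vacuumCoeff_mkQ (q : ℝ) (g : X → H) (η : AlgFock H) :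
    vacuumCoeff q H ((radical q H).mkQ η) = coeff g η [] := by
  rw [vacuumCoeff, vacuum, qInner_mkQ, qForm_algVacuum, coeff, List.map_nil, listTensor_nil]

end

/-! ### Sums of squares in `[0, ∞]` -/

/-- Splitting off the first letter is the recursion behind the energy estimates. Values in `[0, ∞]`
avoid summability conditions, although the alphabet may be infinite. -/
theorem tsum_list {X : Type*} (F : List X → ENNReal) :
    ∑' w, F w = F [] + ∑' x, ∑' w, F (x :: w) := by
  let e : Unit ⊕ (X × List X) ≃ List X :=
    { toFun := Sum.elim (fun _ => []) fun p => p.1 :: p.2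
      invFun := fun
        | [] => Sum.inl ()
        | x :: w => Sum.inr (x, w)
      left_inv := by rintro (_ | ⟨x, w⟩) <;> rfl
      right_inv := by rintro (_ | ⟨x, w⟩) <;> rfl }
  rw [← e.tsum_eq F, Summable.tsum_sum ENNReal.summable ENNReal.summable]
  congr 1
  · simp [e]
  exact ENNReal.tsum_prod (f := fun x w => F (x :: w))

/-- Cauchy–Schwarz; over `Fin N` the factor `s.card` cancels one normalization `1/N`. -/
theorem enorm_sum_sq_le {ι : Type*} (s : Finset ι) (a : ι → ℂ) :
    ‖∑ i ∈ s, a i‖ₑ ^ 2 ≤ s.card * ∑ i ∈ s, ‖a i‖ₑ ^ 2 := by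
  have h : ‖∑ i ∈ s, a i‖₊ ^ 2 ≤ s.card * ∑ i ∈ s, ‖a i‖₊ ^ 2 :=
    (pow_le_pow_left' (nnnorm_sum_le s a) 2).trans sq_sum_le_card_mul_sum_sq
  simp only [enorm_eq_nnnorm]
  exact_mod_cast h

/-- With at most one nonzero term there is no cardinality factor. This saving of a factor `N` is
what makes the error terms small. -/
theorem enorm_sum_sq_le_of_unique {ι : Type*} (s : Finset ι) (a : ι → ℂ)
    (ha : ∀ i ∈ s, ∀ j ∈ s, a i ≠ 0 → a j ≠ 0 → i = j) :
    ‖∑ i ∈ s, a i‖ₑ ^ 2 ≤ ∑ i ∈ s, ‖a i‖ₑ ^ 2 := by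
  by_cases h : ∃ i ∈ s, a i ≠ 0
  · obtain ⟨i, hi, hi0⟩ := h
    rw [Finset.sum_eq_single_of_mem i hi fun j hj hji => by
      by_contra hj0; exact hji (ha j hj i hi hj0 hi0)]
    exact Finset.single_le_sum (f := fun i => ‖a i‖ₑ ^ 2) (fun _ _ => zero_le) hi
  · push Not at h
    rw [Finset.sum_eq_zero h]
    simp

theorem tsum_tsum_ite {X Y ι : Type*} [Fintype ι] [DecidableEq X] (e : ι → X) (G : ι → Y → ENNReal) :
    ∑' y, ∑' w, ∑ l, (if y = e l then G l w else 0) = ∑ l, ∑' w, G l w := by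
  have : ∀ y, ∑' w, ∑ l, (if y = e l then G l w else 0)
      = ∑ l, if y = e l then ∑' w, G l w else 0 := by
    intro y
    rw [Summable.tsum_finsetSum fun _ _ => ENNReal.summable]
    refine Finset.sum_congr rfl fun l _ => ?_
    split_ifs <;> simp
  simp_rw [this]
  rw [Summable.tsum_finsetSum fun _ _ => ENNReal.summable]
  refine Finset.sum_congr rfl fun l _ => ?_
  exact tsum_ite_eq (e l) fun _ => ∑' w, G l w

/-- Inserting letters at a fixed position is injective, so that it does not increase sums. -/
theorem sum_tsum_insertIdx_le {X ι : Type*} [Fintype ι] {e : ι → X} (he : Function.Injective e)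
    (m : ℕ) (φ : List X → ENNReal) :
    ∑ i, ∑' w : List X, (if m ≤ w.length then φ (w.insertIdx m (e i)) else 0) ≤ ∑' w, φ w := by
  induction m generalizing φ with
  | zero =>
    simp only [Nat.zero_le, if_true, List.insertIdx_zero]
    rw [tsum_list φ, ← tsum_fintype (L := SummationFilter.unconditional _)]
    refine le_trans ?_ le_add_self
    exact ENNReal.tsum_comp_le_tsum_of_injective he fun x => ∑' w, φ (x :: w)
  | succ m ih =>
    have h1 : ∀ i, ∑' w : List X, (if m + 1 ≤ w.length then φ (w.insertIdx (m + 1) (e i)) else 0)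
        = ∑' y, ∑' w : List X, (if m ≤ w.length then φ (y :: w.insertIdx m (e i)) else 0) := by
      intro i
      rw [tsum_list]
      simp
    simp_rw [h1]
    rw [← Summable.tsum_finsetSum fun _ _ => ENNReal.summable, tsum_list φ]
    exact le_trans (ENNReal.tsum_le_tsum fun y => ih fun w => φ (y :: w)) le_add_self

/-! ### Matrices of functions of words -/

section

variable {K : Type*} {N : ℕ}

/-- The letter of the `(i, j)` entry of the matrix with label `(k, b)`, transposed if `b`. -/
def edge (c : K × Bool) (i j : Fin N) : K × Fin N × Fin N :=
  if c.2 then (c.1, j, i) else (c.1, i, j)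

/-- The label of the transposed matrix. -/
def flip (c : K × Bool) : K × Bool := (c.1, !c.2)

@[simp] theorem flip_flip (c : K × Bool) : flip (flip c) = c := by simp [flip]

theorem flip_injective : Function.Injective (flip : K × Bool → K × Bool) :=
  Function.LeftInverse.injective flip_flip

theorem edge_flip (c : K × Bool) (i j : Fin N) : edge (flip c) i j = edge c j i := by
  obtain ⟨k, _ | _⟩ := c <;> rfl

theorem edge_inj {c : K × Bool} {i j k l : Fin N} :
    edge c i j = edge c k l ↔ i = k ∧ j = l := by
  obtain ⟨k, _ | _⟩ := c <;> simp [edge, and_comm]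

/-- Different labels share letters only when they are transposes of each other, hence the exchanged
indices. -/
theorem edge_eq_edge_of_ne {c d : K × Bool} (hcd : c ≠ d) {i j k l : Fin N} :
    edge c i j = edge d k l ↔ c.1 = d.1 ∧ i = l ∧ j = k := by
  obtain ⟨k, _ | _⟩ := c <;> obtain ⟨k', _ | _⟩ := d <;> simp_all [edge, and_comm]

variable (K N) in
/-- Matrices with entries functions of words in the letters `(k, i, j)`. -/
abbrev MatFun := Fin N → Fin N → List (K × Fin N × Fin N) → ℂ

variable (N) in
/-- The factor `1 / √N`. -/
def scale : ℂ := (((Real.sqrt N)⁻¹ : ℝ) : ℂ)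

theorem scale_mul_scale : scale N * scale N = (N : ℂ)⁻¹ := by
  rw [scale, ← Complex.ofReal_mul, ← mul_inv, Real.mul_self_sqrt (Nat.cast_nonneg N)]
  simp

theorem enorm_scale_sq [NeZero N] : ‖scale N‖ₑ ^ 2 = (N : ENNReal)⁻¹ := by
  have hN : (N : NNReal) ≠ 0 := Nat.cast_ne_zero.2 (NeZero.ne N)
  rw [← enorm_pow, sq, scale_mul_scale, enorm_inv (Nat.cast_ne_zero.2 (NeZero.ne N))]
  congr 1
  rw [enorm_eq_nnnorm]
  simp

theorem card_mul_inv [NeZero N] : (N : ENNReal) * (N : ENNReal)⁻¹ = 1 :=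
  ENNReal.mul_inv_cancel (Nat.cast_ne_zero.2 (NeZero.ne N)) (ENNReal.natCast_ne_top N)

/-- The action of the left matrix of creation operators with label `c`. -/
def leftCreate (c : K × Bool) (f : MatFun K N) : MatFun K N := fun i j w =>
  scale N * ∑ l, wordCreation (edge c i l) (f l j) w

/-- The action of the left matrix of annihilation operators with label `c`. -/
def leftAnnihilate (q : ℝ) (c : K × Bool) (f : MatFun K N) : MatFun K N := fun i j w =>
  scale N * ∑ l, wordAnnihilation q (edge c l i) (f l j) w

/-- The part of the left matrix of annihilation operators that removes the `m`-th letter. -/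
def leftRemove (m : ℕ) (c : K × Bool) (f : MatFun K N) : MatFun K N := fun i j w =>
  scale N * ∑ l, if m ≤ w.length then f l j (w.insertIdx m (edge c l i)) else 0

/-- Exchange of left and right. -/
def reflect (f : MatFun K N) : MatFun K N := fun i j => wordReverse (f j i)

variable (N) in
/-- The normalized sum of the words of all paths with the given labels. -/
def path : List (K × Bool) → MatFun K N
  | [] => fun i j w => if i = j ∧ w = [] then 1 else 0
  | c :: u => leftCreate c (path u)

@[simp] theorem reflect_reflect (f : MatFun K N) : reflect (reflect f) = f := by
  funext i j; simp [reflect]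

theorem reflect_sub (f g : MatFun K N) : reflect (f - g) = reflect f - reflect g := rfl

@[simp] theorem leftCreate_nil (c : K × Bool) (f : MatFun K N) (i j : Fin N) :
    leftCreate c f i j [] = 0 := by
  simp [leftCreate, wordCreation]

theorem leftCreate_cons [DecidableEq K] (c : K × Bool) (f : MatFun K N) (i j : Fin N) (y) (w) :
    leftCreate c f i j (y :: w) = scale N * ∑ l, if y = edge c i l then f l j w else 0 := by
  simp only [leftCreate, wordCreation]
  congr 1
  refine Finset.sum_congr rfl fun l _ => ?_
  split_ifs <;> rfl

theorem leftCreate_sub (c : K × Bool) (f g : MatFun K N) :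
    leftCreate c (f - g) = leftCreate c f - leftCreate c g := by
  classical
  funext i j w
  cases w with
  | nil => simp
  | cons y w =>
    simp only [Pi.sub_apply, leftCreate_cons, ← mul_sub, ← Finset.sum_sub_distrib]
    congr 1
    refine Finset.sum_congr rfl fun l _ => ?_
    split_ifs <;> simp

theorem leftAnnihilate_sub (q : ℝ) (c : K × Bool) (f g : MatFun K N) :
    leftAnnihilate q c (f - g) = leftAnnihilate q c f - leftAnnihilate q c g := by
  funext i j w
  simp only [Pi.sub_apply, leftAnnihilate, wordAnnihilation, ← mul_sub, ← Finset.sum_sub_distrib]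

/-- Bounded support makes the range of positions independent of the word, so each position can be
estimated separately. -/
theorem leftAnnihilate_eq_sum (q : ℝ) (c : K × Bool) (f : MatFun K N) {M : ℕ}
    (hf : ∀ i j w, M < w.length → f i j w = 0) :
    leftAnnihilate q c f = ∑ m ∈ Finset.range (M + 1), (q : ℂ) ^ m • leftRemove m c f := by
  funext i j w
  simp only [leftAnnihilate, wordAnnihilation, Finset.sum_apply, Pi.smul_apply, smul_eq_mul,
    leftRemove]
  rw [Finset.sum_comm, Finset.mul_sum]
  have hlen : ∀ m, m ≤ w.length → ∀ x, (w.insertIdx m x).length = w.length + 1 :=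
    fun m hm x => List.length_insertIdx_of_le_length hm x
  by_cases hw : M ≤ w.length
  -- Here every word obtained by insertion is longer than `M`, so both sides vanish.
  · rw [Finset.sum_eq_zero, Finset.sum_eq_zero]
    · intro m _
      rw [Finset.sum_eq_zero, mul_zero, mul_zero]
      intro l _
      split_ifs with hm
      · exact hf _ _ _ (by rw [hlen m hm]; omega)
      · rfl
    · intro m hm
      rw [Finset.sum_eq_zero, mul_zero]
      intro l _
      rw [hf _ _ _ (by rw [hlen m (by simpa [Nat.lt_succ_iff] using hm)]; omega), mul_zero]
  -- The additional positions lie beyond the end of `w` and are discarded by the guard in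
  -- `leftRemove`.
  · rw [← Finset.sum_subset (Finset.range_subset_range.2 (by omega : w.length + 1 ≤ M + 1))]
    · refine Finset.sum_congr rfl fun m hm => ?_
      have hm' : m ≤ w.length := by simpa [Nat.lt_succ_iff] using hm
      simp only [hm', if_true, ← Finset.mul_sum]
      ring
    · intro m _ hm
      have hm' : ¬ m ≤ w.length := by simpa [Nat.lt_succ_iff] using hm
      simp [hm']

/-! ### Paths and reflection -/

theorem reflect_leftCreate_nil (c : K × Bool) (f : MatFun K N) (i j : Fin N) :
    reflect (leftCreate (flip c) (reflect f)) i j [] = 0 := by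
  simp [reflect, wordReverse]

theorem reflect_leftCreate_concat [DecidableEq K] (c : K × Bool) (f : MatFun K N) (i j : Fin N) (y) (w) :
    reflect (leftCreate (flip c) (reflect f)) i j (w ++ [y])
      = scale N * ∑ l, if y = edge c l j then f i l w else 0 := by
  simp [reflect, wordReverse, leftCreate_cons, edge_flip]

/-- Left and right creation act on opposite ends of the word and on different matrix indices, so on
words of length at least two both orders give the same double sum. On shorter words both sides
vanish. -/
theorem leftCreate_reflect_comm (c d : K × Bool) (f : MatFun K N) :
    leftCreate c (reflect (leftCreate (flip d) (reflect f)))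
      = reflect (leftCreate (flip d) (reflect (leftCreate c f))) := by
  classical
  funext i j w
  rcases w with _ | ⟨y, w⟩
  · rw [leftCreate_nil, reflect_leftCreate_nil]
  · rcases List.eq_nil_or_concat' w with rfl | ⟨w, z, rfl⟩
    · rw [leftCreate_cons, ← List.nil_append [y], reflect_leftCreate_concat]
      simp [reflect_leftCreate_nil]
    · rw [leftCreate_cons, ← List.cons_append, reflect_leftCreate_concat]
      simp only [reflect_leftCreate_concat, leftCreate_cons]
      congr 1
      have h : ∀ (p : Prop) [Decidable p] (a b : ℂ),
          (if p then a * b else 0) = a * (if p then b else 0) := by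
        intro p _ a b; split_ifs <;> simp
      simp only [h, ← Finset.mul_sum]
      congr 1
      have h2 : ∀ (p : Prop) [Decidable p] (a : Fin N → ℂ),
          (if p then ∑ l, a l else 0) = ∑ l, (if p then a l else 0) := by
        intro p _ a; split_ifs <;> simp
      simp only [h2]
      rw [Finset.sum_comm]
      refine Finset.sum_congr rfl fun l _ => Finset.sum_congr rfl fun l' _ => ?_
      split_ifs <;> rfl

theorem path_cons [DecidableEq K] (c : K × Bool) (u : List (K × Bool)) (i j : Fin N) (y) (w) :
    path N (c :: u) i j (y :: w)
      = scale N * ∑ l, if y = edge c i l then path N u l j w else 0 :=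
  leftCreate_cons c _ i j y w

@[simp] theorem path_cons_nil (c : K × Bool) (u : List (K × Bool)) (i j : Fin N) :
    path N (c :: u) i j [] = 0 :=
  leftCreate_nil c _ i j

/-- Paths can equally be built from the right. The `flip` compensates the transposition inside
`reflect`. -/
theorem path_concat (u : List (K × Bool)) (d : K × Bool) :
    path N (u ++ [d]) = reflect (leftCreate (flip d) (reflect (path N u))) := by
  classical
  induction u with
  | nil =>
    funext i j w
    rcases List.eq_nil_or_concat' w with rfl | ⟨w, y, rfl⟩
    · rw [reflect_leftCreate_nil, List.nil_append, path_cons_nil]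
    · rw [reflect_leftCreate_concat, List.nil_append]
      rcases w with _ | ⟨z, w⟩
      · rw [List.nil_append, path_cons]
        congr 1
        rw [Finset.sum_eq_single j, Finset.sum_eq_single i]
        · simp [path]
        · intro l _ hl
          simp [path, Ne.symm hl]
        · simp
        · intro l _ hl
          simp [path, hl]
        · simp
      · rw [List.cons_append, path_cons]
        simp [path]
  | cons c u ih =>
    rw [List.cons_append, path, ih, leftCreate_reflect_comm, path]

theorem reflect_path (u : List (K × Bool)) :
    reflect (path N u) = path N (u.map flip).reverse := by
  induction u with
  | nil =>
    funext i j w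
    simp [path, reflect, wordReverse, eq_comm (a := j)]
  | cons c u ih =>
    rw [List.map_cons, List.reverse_cons, path_concat, ← ih, flip_flip, reflect_reflect, path]

theorem path_eq_zero {u : List (K × Bool)} {i j : Fin N} {w} (hw : w.length ≠ u.length) :
    path N u i j w = 0 := by
  classical
  induction u generalizing i j w with
  | nil =>
    rcases w with _ | ⟨y, w⟩
    · simp at hw
    · simp [path]
  | cons c u ih =>
    rcases w with _ | ⟨y, w⟩
    · simp [path]
    · rw [path, leftCreate_cons]
      have : w.length ≠ u.length := by simpa using hw
      simp [ih this]

/-! ### Energy estimates -/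

/-- The squared `ℓ²` norm of a row. -/
def rowEnergy (f : MatFun K N) (i : Fin N) : ENNReal := ∑ j, ∑' w, ‖f i j w‖ₑ ^ 2

/-- The squared `ℓ²` norm. -/
def energy (f : MatFun K N) : ENNReal := ∑ i, rowEnergy f i

theorem energy_zero : energy (0 : MatFun K N) = 0 := by simp [energy, rowEnergy]

theorem energy_reflect (f : MatFun K N) : energy (reflect f) = energy f := by
  unfold energy rowEnergy
  rw [Finset.sum_comm]
  refine Finset.sum_congr rfl fun i _ => Finset.sum_congr rfl fun j _ => ?_
  exact (Equiv.ofBijective _ List.reverse_bijective).tsum_eq fun w => ‖f i j w‖ₑ ^ 2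

theorem energy_sum_le {ι : Type*} (s : Finset ι) (f : ι → MatFun K N) :
    energy (∑ m ∈ s, f m) ≤ s.card * ∑ m ∈ s, energy (f m) := by
  unfold energy rowEnergy
  conv_rhs => rw [Finset.sum_comm, Finset.mul_sum]
  refine Finset.sum_le_sum fun i _ => ?_
  conv_rhs => rw [Finset.sum_comm, Finset.mul_sum]
  refine Finset.sum_le_sum fun j _ => ?_
  rw [← Summable.tsum_finsetSum fun _ _ => ENNReal.summable, ← ENNReal.tsum_mul_left]
  refine ENNReal.tsum_le_tsum fun w => ?_
  simp only [Finset.sum_apply]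
  exact enorm_sum_sq_le s _

theorem energy_add_le (f g : MatFun K N) : energy (f + g) ≤ 2 * (energy f + energy g) := by
  have := energy_sum_le Finset.univ fun b : Bool => if b then f else g
  simpa using this

theorem energy_smul (c : ℂ) (f : MatFun K N) : energy (c • f) = ‖c‖ₑ ^ 2 * energy f := by
  simp [energy, rowEnergy, Finset.mul_sum, ENNReal.tsum_mul_left, enorm_mul, mul_pow]

theorem energy_smul_le {c : ℂ} (hc : ‖c‖ₑ ≤ 1) (f : MatFun K N) :
    energy (c • f) ≤ energy f := by
  rw [energy_smul]
  exact mul_le_of_le_one_left zero_le (pow_le_one₀ zero_le hc)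

theorem enorm_leftCreate_cons_sq_le [NeZero N] [DecidableEq K] (c : K × Bool) (f : MatFun K N)
    (i j : Fin N) (y) (w) : ‖leftCreate c f i j (y :: w)‖ₑ ^ 2
      ≤ (N : ENNReal)⁻¹ * ∑ l, if y = edge c i l then ‖f l j w‖ₑ ^ 2 else 0 := by
  rw [leftCreate_cons, enorm_mul, mul_pow, enorm_scale_sq]
  gcongr
  refine (enorm_sum_sq_le_of_unique _ _ ?_).trans_eq ?_
  · intro l _ l' _ hl hl'
    simp only [ne_eq, ite_eq_right_iff, Classical.not_imp] at hl hl'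
    exact (edge_inj.1 (hl.1.symm.trans hl'.1)).2
  · refine Finset.sum_congr rfl fun l _ => ?_
    split_ifs <;> simp

/-- The new first letter determines the summation index, so no cross terms occur, and every row
receives at most the average of the row energies of `f`. -/
theorem rowEnergy_leftCreate_le [NeZero N] (c : K × Bool) (f : MatFun K N) (i : Fin N) :
    rowEnergy (leftCreate c f) i ≤ (N : ENNReal)⁻¹ * energy f := by
  classical
  unfold energy rowEnergy
  rw [Finset.sum_comm, Finset.mul_sum]
  refine Finset.sum_le_sum fun j _ => ?_
  rw [tsum_list, leftCreate_nil, ← tsum_tsum_ite (edge c i)]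
  simp only [← ENNReal.tsum_mul_left, enorm_zero, ne_eq, OfNat.ofNat_ne_zero, not_false_eq_true,
    zero_pow, zero_add]
  exact ENNReal.tsum_le_tsum fun y => ENNReal.tsum_le_tsum fun w =>
    enorm_leftCreate_cons_sq_le c f i j y w

theorem energy_leftCreate_le [NeZero N] (c : K × Bool) (f : MatFun K N) :
    energy (leftCreate c f) ≤ energy f := by
  refine (Finset.sum_le_sum fun i _ => rowEnergy_leftCreate_le c f i).trans_eq ?_
  rw [Finset.sum_const, Finset.card_univ, Fintype.card_fin, nsmul_eq_mul, ← mul_assoc,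
    card_mul_inv, one_mul]

/-- The factor `N` of Cauchy–Schwarz cancels `‖scale N‖ₑ ^ 2`. For fixed `l`, the letters for
different `i` are distinct, so insertion repeats no word. -/
theorem energy_leftRemove_le [NeZero N] (m : ℕ) (c : K × Bool) (f : MatFun K N) :
    energy (leftRemove m c f) ≤ energy f := by
  have h1 : ∀ i j w, ‖leftRemove m c f i j w‖ₑ ^ 2
      ≤ ∑ l, if m ≤ w.length then ‖f l j (w.insertIdx m (edge c l i))‖ₑ ^ 2 else 0 := by
    intro i j w
    rw [leftRemove, enorm_mul, mul_pow, enorm_scale_sq]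
    calc _ ≤ (N : ENNReal)⁻¹ * ((Finset.univ : Finset (Fin N)).card * _) := by
          gcongr; exact enorm_sum_sq_le _ _
      _ = _ := by
          rw [Finset.card_univ, Fintype.card_fin, ← mul_assoc, mul_comm _ (N : ENNReal),
            card_mul_inv, one_mul]
          refine Finset.sum_congr rfl fun l _ => ?_
          split_ifs <;> simp
  unfold energy rowEnergy
  rw [Finset.sum_comm, Finset.sum_comm (f := fun i j => ∑' w, ‖f i j w‖ₑ ^ 2)]
  refine Finset.sum_le_sum fun j _ => ?_
  calc ∑ i, ∑' w, ‖leftRemove m c f i j w‖ₑ ^ 2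
      ≤ ∑ i, ∑' w : List (K × Fin N × Fin N), ∑ l,
          if m ≤ w.length then ‖f l j (w.insertIdx m (edge c l i))‖ₑ ^ 2 else 0 :=
        Finset.sum_le_sum fun i _ => ENNReal.tsum_le_tsum fun w => h1 i j w
    _ = ∑ l, ∑ i, ∑' w : List (K × Fin N × Fin N),
          if m ≤ w.length then ‖f l j (w.insertIdx m (edge c l i))‖ₑ ^ 2 else 0 := by
        rw [Finset.sum_comm]
        exact Finset.sum_congr rfl fun i _ => Summable.tsum_finsetSum fun _ _ => ENNReal.summable
    _ ≤ _ := Finset.sum_le_sum fun l _ =>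
        sum_tsum_insertIdx_le (fun a b hab => (edge_inj.1 hab).2) m fun w => ‖f l j w‖ₑ ^ 2

theorem rowEnergy_path_le [NeZero N] (u : List (K × Bool)) (i : Fin N) :
    rowEnergy (path N u) i ≤ 1 := by
  induction u generalizing i with
  | nil =>
    rw [rowEnergy, Finset.sum_eq_single i, tsum_eq_single []]
    · simp [path]
    · intro w hw; simp [path, hw]
    · intro j _ hj; simp [path, Ne.symm hj]
    · simp
  | cons c u ih =>
    refine (rowEnergy_leftCreate_le c _ i).trans ?_
    refine (mul_le_mul_right (Finset.sum_le_sum fun i _ => ih i) _).trans_eq ?_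
    simp [mul_comm _ (N : ENNReal), card_mul_inv]

theorem energy_path_le [NeZero N] (u : List (K × Bool)) : energy (path N u) ≤ N :=
  (Finset.sum_le_sum fun i _ => rowEnergy_path_le u i).trans_eq (by simp)

/-- The squared `ℓ²` norm of the part of row `i₀` of `path N u` whose `m`-th letter belongs to the
`k`-th row of the matrix with label `c`. -/
def pinnedEnergy (u : List (K × Bool)) (m : ℕ) (c : K × Bool) (k i₀ : Fin N) : ENNReal :=
  ∑ i, ∑ j, ∑' w : List (K × Fin N × Fin N),
    if m ≤ w.length then ‖path N u i₀ j (w.insertIdx m (edge c k i))‖ₑ ^ 2 else 0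

/-- Prescribing the first letter leaves at most one choice of starting row and next index, hence at
most `1/N` for each of the `N` values of `i`. -/
theorem sum_pinnedEnergy_zero_le [NeZero N] (u : List (K × Bool)) (c : K × Bool) (k : Fin N) :
    ∑ i₀, pinnedEnergy u 0 c k i₀ ≤ 1 := by
  classical
  unfold pinnedEnergy
  simp only [Nat.zero_le, if_true, List.insertIdx_zero]
  cases u with
  | nil => simp [path]
  | cons d u =>
    rw [Finset.sum_comm]
    have key : ∀ i : Fin N, ∑ i₀, ∑ j, ∑' w, ‖path N (d :: u) i₀ j (edge c k i :: w)‖ₑ ^ 2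
        ≤ (N : ENNReal)⁻¹ := by
      intro i
      calc ∑ i₀, ∑ j, ∑' w, ‖path N (d :: u) i₀ j (edge c k i :: w)‖ₑ ^ 2
          ≤ ∑ i₀, ∑ j, ∑' w, (N : ENNReal)⁻¹ * ∑ l,
              if edge c k i = edge d i₀ l then ‖path N u l j w‖ₑ ^ 2 else 0 :=
            Finset.sum_le_sum fun i₀ _ => Finset.sum_le_sum fun j _ =>
              ENNReal.tsum_le_tsum fun w => enorm_leftCreate_cons_sq_le d _ i₀ j _ w
        _ = (N : ENNReal)⁻¹ * ∑ i₀, ∑ l,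
              if edge c k i = edge d i₀ l then rowEnergy (path N u) l else 0 := by
            simp only [ENNReal.tsum_mul_left, ← Finset.mul_sum]
            congr 1
            refine Finset.sum_congr rfl fun i₀ _ => ?_
            simp only [Summable.tsum_finsetSum fun _ _ => ENNReal.summable]
            rw [Finset.sum_comm]
            refine Finset.sum_congr rfl fun l _ => ?_
            split_ifs <;> simp [rowEnergy]
        _ ≤ (N : ENNReal)⁻¹ * ∑ p : Fin N × Fin N,
              if edge c k i = edge d p.1 p.2 then 1 else 0 := by
            rw [Fintype.sum_prod_type]
            gcongr
            split_ifs
            · exact rowEnergy_path_le u _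
            · exact le_rfl
        _ ≤ (N : ENNReal)⁻¹ * 1 := by
            gcongr
            rw [Finset.sum_boole]
            norm_cast
            rw [Finset.card_le_one]
            intro p hp p' hp'
            rw [Finset.mem_filter] at hp hp'
            exact Prod.ext_iff.2 (edge_inj.1 (hp.2.symm.trans hp'.2))
        _ = (N : ENNReal)⁻¹ := mul_one _
    refine (Finset.sum_le_sum fun i _ => key i).trans_eq ?_
    simp [card_mul_inv]

/-- Insertion at `m + 1` leaves the first letter in place, so that letter can be peeled off. -/
theorem pinnedEnergy_succ_le [NeZero N] (d : K × Bool) (u : List (K × Bool)) (m : ℕ)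
    (c : K × Bool) (k i₀ : Fin N) :
    pinnedEnergy (d :: u) (m + 1) c k i₀ ≤ (N : ENNReal)⁻¹ * ∑ l, pinnedEnergy u m c k l := by
  classical
  unfold pinnedEnergy
  conv_rhs => rw [Finset.sum_comm, Finset.mul_sum]
  refine Finset.sum_le_sum fun i _ => ?_
  conv_rhs => rw [Finset.sum_comm, Finset.mul_sum]
  refine Finset.sum_le_sum fun j _ => ?_
  rw [tsum_list, ← tsum_tsum_ite (edge d i₀)]
  simp only [List.length_nil, Nat.le_zero_eq, Nat.add_eq_zero_iff, one_ne_zero, and_false,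
    if_false, zero_add, List.length_cons, Nat.add_le_add_iff_right, List.insertIdx_succ_cons,
    ← ENNReal.tsum_mul_left]
  refine ENNReal.tsum_le_tsum fun y => ENNReal.tsum_le_tsum fun w => ?_
  split_ifs
  · exact enorm_leftCreate_cons_sq_le d _ i₀ j _ _
  · exact zero_le

theorem sum_pinnedEnergy_le [NeZero N] (u : List (K × Bool)) (m : ℕ) (c : K × Bool) (k : Fin N) :
    ∑ i₀, pinnedEnergy u m c k i₀ ≤ 1 := by
  induction u generalizing m with
  | nil =>
    have : ∀ i₀, pinnedEnergy [] m c k i₀ = 0 := by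
      intro i₀
      unfold pinnedEnergy
      refine Finset.sum_eq_zero fun i _ => Finset.sum_eq_zero fun j _ =>
        ENNReal.tsum_eq_zero.2 fun w => ?_
      split_ifs with hm
      · rw [path_eq_zero (by simp [List.length_insertIdx_of_le_length hm])]
        simp
      · rfl
    simp [this]
  | cons d u ih =>
    cases m with
    | zero => exact sum_pinnedEnergy_zero_le _ c k
    | succ m =>
      refine (Finset.sum_le_sum fun i₀ _ => (pinnedEnergy_succ_le d u m c k i₀).trans
        (mul_le_mul_right (ih m) _)).trans_eq ?_
      simp [card_mul_inv]

/-- Removing a letter that is not the first one from a path gives a small vector. -/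
theorem energy_leftRemove_succ_path_le [NeZero N] (m : ℕ) (c : K × Bool) (u : List (K × Bool)) :
    energy (leftRemove (m + 1) c (path N u)) ≤ (N : ENNReal)⁻¹ := by
  classical
  cases u with
  | nil =>
    have : leftRemove (m + 1) c (path N []) = 0 := by
      funext i j w
      simp only [leftRemove]
      rw [Finset.sum_eq_zero, mul_zero]; · rfl
      intro l _
      split_ifs with hm
      · exact path_eq_zero (by simp [List.length_insertIdx_of_le_length hm])
      · rfl
    rw [this, energy_zero]
    exact zero_le
  | cons d u =>
    have h1 : ∀ i j w, ‖leftRemove (m + 1) c (path N (d :: u)) i j w‖ₑ ^ 2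
        ≤ (N : ENNReal)⁻¹ * ∑ k, if m + 1 ≤ w.length then
          ‖path N (d :: u) k j (w.insertIdx (m + 1) (edge c k i))‖ₑ ^ 2 else 0 := by
      intro i j w
      rw [leftRemove, enorm_mul, mul_pow, enorm_scale_sq]
      gcongr
      refine (enorm_sum_sq_le_of_unique _ _ ?_).trans_eq ?_
      -- The first letter of the path survives the removal and determines the row `k`, so at most
      -- one summand is nonzero.
      · have key : ∀ k, (if m + 1 ≤ w.length then
            path N (d :: u) k j (w.insertIdx (m + 1) (edge c k i)) else 0) ≠ 0 →
            ∃ l, w.head? = some (edge d k l) := by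
          intro k hk
          rcases w with _ | ⟨y, w⟩
          · simp at hk
          · simp only [List.head?_cons, Option.some.injEq]
            by_contra hne
            push Not at hne
            apply hk
            simp [path, leftCreate_cons, hne]
        intro k _ k' _ hk hk'
        obtain ⟨l, hl⟩ := key k hk
        obtain ⟨l', hl'⟩ := key k' hk'
        exact (edge_inj.1 (Option.some_injective _ (hl.symm.trans hl'))).1
      · refine Finset.sum_congr rfl fun l _ => ?_
        split_ifs <;> simp
    calc energy (leftRemove (m + 1) c (path N (d :: u)))
        ≤ ∑ i, ∑ j, ∑' w : List (K × Fin N × Fin N), (N : ENNReal)⁻¹ * ∑ k,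
            if m + 1 ≤ w.length then
              ‖path N (d :: u) k j (w.insertIdx (m + 1) (edge c k i))‖ₑ ^ 2 else 0 :=
          Finset.sum_le_sum fun i _ => Finset.sum_le_sum fun j _ =>
            ENNReal.tsum_le_tsum fun w => h1 i j w
      -- The starting row and the row of the removed letter coincide. This diagonal constraint is
      -- the source of the gain.
      _ = (N : ENNReal)⁻¹ * ∑ k, pinnedEnergy (d :: u) (m + 1) c k k := by
          simp only [ENNReal.tsum_mul_left, ← Finset.mul_sum]
          congr 1
          simp only [Summable.tsum_finsetSum fun _ _ => ENNReal.summable]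
          rw [Finset.sum_congr rfl fun i _ => Finset.sum_comm, Finset.sum_comm]
          rfl
      _ ≤ (N : ENNReal)⁻¹ * ∑ k : Fin N, (N : ENNReal)⁻¹ := by
          gcongr with k
          refine (pinnedEnergy_succ_le d u m c k k).trans ?_
          exact (mul_le_mul_right (sum_pinnedEnergy_le u m c k) _).trans_eq (mul_one _)
      _ = (N : ENNReal)⁻¹ := by simp [card_mul_inv]

/-- With equal labels the letters match for `l = i` and every `k`, and these `N` terms cancel `N⁻¹`.
With transposed labels only `k = l = i` remains, leaving `N⁻¹ • path N u`, of energy at most `N⁻² *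
N`. Other labels give zero. -/
theorem leftRemove_zero_path_cons [NeZero N] (c d : K × Bool) (u : List (K × Bool)) :
    (c = d → leftRemove 0 c (path N (d :: u)) = path N u) ∧
    (c ≠ d → energy (leftRemove 0 c (path N (d :: u))) ≤ (N : ENNReal)⁻¹) := by
  classical
  have h0 : ∀ i j w, leftRemove 0 c (path N (d :: u)) i j w
      = (N : ℂ)⁻¹ * ∑ k, ∑ l, if edge c k i = edge d k l then path N u l j w else 0 := by
    intro i j w
    simp only [leftRemove, Nat.zero_le, if_true, List.insertIdx_zero, path, leftCreate_cons]
    rw [← Finset.mul_sum, ← mul_assoc, scale_mul_scale]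
  constructor
  · rintro rfl
    funext i j w
    rw [h0]
    simp only [edge_inj, true_and, Finset.sum_ite_eq, Finset.mem_univ, if_true, Finset.sum_const,
      Finset.card_univ, Fintype.card_fin, nsmul_eq_mul]
    rw [inv_mul_cancel_left₀ (Nat.cast_ne_zero.2 (NeZero.ne N))]
  · intro hcd
    have h1 : leftRemove 0 c (path N (d :: u))
        = (N : ℂ)⁻¹ • (if c.1 = d.1 then (1 : ℂ) else 0) • path N u := by
      funext i j w
      rw [h0]
      simp only [edge_eq_edge_of_ne hcd, Pi.smul_apply, smul_eq_mul]
      congr 1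
      rw [Finset.sum_eq_single i, Finset.sum_eq_single i]
      · simp
      · intro l _ hl
        simp [Ne.symm hl]
      · simp
      · intro k _ hk
        simp [Ne.symm hk]
      · simp
    rw [h1, energy_smul, ← scale_mul_scale, ← sq, enorm_pow, ← pow_mul, mul_comm 2, pow_mul,
      enorm_scale_sq, sq, mul_assoc]
    refine (mul_le_mul_right (mul_le_mul_right ((energy_smul_le ?_ _).trans (energy_path_le u)) _)
      _).trans_eq ?_
    · split_ifs <;> simp
    · rw [mul_comm _ (N : ENNReal), card_mul_inv, mul_one]

end

/-! ### The limiting action on words of labels -/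

section

variable {L : Type*}

open Classical in
/-- Left creation (`false`) and left annihilation (`true`) of a label on the words that index the
basis of the full Fock space; `none` stands for the zero vector. -/
def leftStep : Bool → L → List L → Option (List L)
  | false, c, u => some (c :: u)
  | true, _, [] => none
  | true, c, d :: u => if c = d then some u else none

/-- Creation and annihilation of a label at either side of a word. -/
def sideStep (s : Side) (b : Bool) (c : L) (u : List L) : Option (List L) :=
  match s with
  | .left => leftStep b c u
  | .right => (leftStep b c u.reverse).map List.reverse

theorem leftStep_map {L' : Type*} {f : L → L'} (hf : Function.Injective f) (b : Bool) (c : L)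
    (u : List L) : leftStep b (f c) (u.map f) = (leftStep b c u).map (List.map f) := by
  rcases b with _ | _
  · rfl
  · rcases u with _ | ⟨d, u⟩
    · rfl
    · by_cases h : c = d
      · simp [leftStep, h]
      · simp [leftStep, h, hf.ne h]

theorem length_leftStep_le {b : Bool} {c : L} {u v : List L} (h : leftStep b c u = some v) :
    v.length ≤ u.length + 1 := by
  rcases b with _ | _
  · obtain rfl : c :: u = v := by simpa [leftStep] using h
    simp
  · rcases u with _ | ⟨d, u⟩
    · simp [leftStep] at h
    · simp only [leftStep, Option.ite_none_right_eq_some, Option.some.injEq] at h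
      obtain ⟨-, rfl⟩ := h
      simp only [List.length_cons]
      omega

theorem length_sideStep_le {s : Side} {b : Bool} {c : L} {u v : List L}
    (h : sideStep s b c u = some v) : v.length ≤ u.length + 1 := by
  cases s with
  | left => exact length_leftStep_le h
  | right =>
    simp only [sideStep, Option.map_eq_some_iff] at h
    obtain ⟨v, hv, rfl⟩ := h
    simpa using length_leftStep_le hv

end

section

variable {K : Type*}

/-- Whether a decoration is a transposed one. -/
def Deco.isTr : Deco → Bool
  | .plain | .adj => false
  | .tr | .trAdj => true

/-- Whether a decoration is that of an annihilation operator. -/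
def Deco.isAdj : Deco → Bool
  | .plain | .tr => false
  | .adj | .trAdj => true

/-- The label of a matrix. -/
def label (t : K × Side × Deco) : K × Bool := (t.1, t.2.2.isTr)

/-- The result of the action of a product of limit operators on the vacuum. -/
def limitWord : List (K × Side × Deco) → Option (List (K × Bool))
  | [] => some []
  | t :: ts => (limitWord ts).bind (sideStep t.2.1 t.2.2.isAdj (label t))

theorem length_limitWord_le (ts : List (K × Side × Deco)) {u : List (K × Bool)}
    (h : limitWord ts = some u) : u.length ≤ ts.length := by
  induction ts generalizing u with
  | nil =>
    obtain rfl : [] = u := by simpa [limitWord] using h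
    simp
  | cons t ts ih =>
    obtain ⟨v, hv, h⟩ := Option.bind_eq_some_iff.1 h
    exact (length_sideStep_le h).trans (by simpa using ih hv)

/-! ### Products of matrices act on paths up to small vectors -/

variable {N : ℕ}

/-- The action of a left matrix of creation (`false`) or annihilation (`true`) operators. -/
def leftAct (q : ℝ) (b : Bool) (c : K × Bool) (f : MatFun K N) : MatFun K N :=
  match b with
  | false => leftCreate c f
  | true => leftAnnihilate q c f

/-- The action of a matrix of creation (`false`) or annihilation (`true`) operators. -/
def sideAct (q : ℝ) (s : Side) (b : Bool) (c : K × Bool) (f : MatFun K N) : MatFun K N :=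
  match s with
  | .left => leftAct q b c f
  | .right => reflect (leftAct q b (flip c) (reflect f))

variable (N) in
/-- The result of the action of a product of matrices on the vacuum. -/
def evolve (q : ℝ) : List (K × Side × Deco) → MatFun K N
  | [] => path N []
  | t :: ts => sideAct q t.2.1 t.2.2.isAdj (label t) (evolve q ts)

variable (N) in
/-- The path vector of a word, and zero for `none`. -/
def optPath (o : Option (List (K × Bool))) : MatFun K N := o.elim 0 (path N)

theorem leftAct_sub (q : ℝ) (b : Bool) (c : K × Bool) (f g : MatFun K N) :
    leftAct q b c (f - g) = leftAct q b c f - leftAct q b c g := by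
  rcases b with _ | _
  · exact leftCreate_sub c f g
  · exact leftAnnihilate_sub q c f g

theorem sideAct_sub (q : ℝ) (s : Side) (b : Bool) (c : K × Bool) (f g : MatFun K N) :
    sideAct q s b c (f - g) = sideAct q s b c f - sideAct q s b c g := by
  cases s with
  | left => exact leftAct_sub q b c f g
  | right => simp only [sideAct, reflect_sub, leftAct_sub]

theorem sideAct_zero (q : ℝ) (s : Side) (b : Bool) (c : K × Bool) :
    sideAct q s b c (0 : MatFun K N) = 0 := by
  have := sideAct_sub q s b c (0 : MatFun K N) 0
  simpa using this

/-- A function is supported on words of length at most `M`. -/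
def SupportedUpTo (M : ℕ) (f : MatFun K N) : Prop := ∀ i j w, M < w.length → f i j w = 0

theorem SupportedUpTo.mono {M M' : ℕ} (h : M ≤ M') {f : MatFun K N} (hf : SupportedUpTo M f) :
    SupportedUpTo M' f := fun i j w hw => hf i j w (h.trans_lt hw)

theorem SupportedUpTo.sub {M : ℕ} {f g : MatFun K N} (hf : SupportedUpTo M f)
    (hg : SupportedUpTo M g) : SupportedUpTo M (f - g) := fun i j w hw => by
  simp [hf i j w hw, hg i j w hw]

theorem SupportedUpTo.reflect {M : ℕ} {f : MatFun K N} (hf : SupportedUpTo M f) :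
    SupportedUpTo M (reflect f) := fun i j w hw => hf j i _ (by simpa using hw)

theorem SupportedUpTo.leftAct {M : ℕ} {f : MatFun K N} (hf : SupportedUpTo M f) (q : ℝ) (b : Bool)
    (c : K × Bool) : SupportedUpTo (M + 1) (leftAct q b c f) := by
  classical
  intro i j w hw
  rcases b with _ | _
  · rcases w with _ | ⟨y, w⟩
    · simp at hw
    · simp only [QBiMatrix.leftAct, leftCreate_cons]
      have : M < w.length := by simpa using hw
      simp [hf _ _ w this]
  · simp only [QBiMatrix.leftAct, leftAnnihilate, wordAnnihilation]
    rw [Finset.sum_eq_zero, mul_zero]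
    intro l _
    refine Finset.sum_eq_zero fun m _ => ?_
    rw [hf, mul_zero]
    exact (by omega : M < w.length).trans_le List.length_le_length_insertIdx

theorem SupportedUpTo.sideAct {M : ℕ} {f : MatFun K N} (hf : SupportedUpTo M f) (q : ℝ) (s : Side)
    (b : Bool) (c : K × Bool) : SupportedUpTo (M + 1) (sideAct q s b c f) := by
  cases s with
  | left => exact hf.leftAct q b c
  | right => exact (hf.reflect.leftAct q b _).reflect

theorem supportedUpTo_path (u : List (K × Bool)) : SupportedUpTo u.length (path N u) :=
  fun _ _ _ hw => path_eq_zero hw.ne'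

theorem supportedUpTo_evolve (q : ℝ) (ts : List (K × Side × Deco)) :
    SupportedUpTo ts.length (evolve N q ts) := by
  induction ts with
  | nil => exact supportedUpTo_path []
  | cons t ts ih => exact ih.sideAct q _ _ _

theorem supportedUpTo_optPath_limitWord (ts : List (K × Side × Deco)) :
    SupportedUpTo ts.length (optPath N (limitWord ts)) := by
  cases h : limitWord ts with
  | none => intro _ _ _ _; rfl
  | some u => exact (supportedUpTo_path u).mono (length_limitWord_le ts h)

theorem enorm_pow_le_one {q : ℝ} (hq : q ∈ Set.Icc (-1 : ℝ) 1) (m : ℕ) : ‖(q : ℂ) ^ m‖ₑ ≤ 1 := by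
  rw [enorm_pow]
  refine pow_le_one₀ zero_le ?_
  rw [← enorm_one (G := ℂ), enorm_le_iff_norm_le]
  simpa [abs_le] using hq

/-- Annihilation is a sum of `M + 1` contractions with weights of modulus at most one. One factor `M
+ 1` comes from Cauchy–Schwarz, the other from the number of terms. -/
theorem energy_leftAct_le [NeZero N] {q : ℝ} (hq : q ∈ Set.Icc (-1 : ℝ) 1) (b : Bool) (c : K × Bool) {M : ℕ}
    {f : MatFun K N} (hf : SupportedUpTo M f) :
    energy (leftAct q b c f) ≤ (M + 1) ^ 2 * energy f := by
  rcases b with _ | _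
  · refine (energy_leftCreate_le c f).trans (le_mul_of_one_le_left zero_le ?_)
    exact one_le_pow₀ le_add_self
  · rw [leftAct, leftAnnihilate_eq_sum q c f hf]
    refine (energy_sum_le _ _).trans ?_
    refine (mul_le_mul_right (Finset.sum_le_sum fun m _ =>
      (energy_smul_le (enorm_pow_le_one hq m) _).trans (energy_leftRemove_le m c f)) _).trans_eq ?_
    simp only [Finset.card_range, Finset.sum_const, nsmul_eq_mul]
    push_cast
    ring

theorem energy_sideAct_le [NeZero N] {q : ℝ} (hq : q ∈ Set.Icc (-1 : ℝ) 1) (s : Side) (b : Bool)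
    (c : K × Bool) {M : ℕ} {f : MatFun K N} (hf : SupportedUpTo M f) :
    energy (sideAct q s b c f) ≤ (M + 1) ^ 2 * energy f := by
  cases s with
  | left => exact energy_leftAct_le hq b c hf
  | right =>
    rw [sideAct, energy_reflect, ← energy_reflect f]
    exact energy_leftAct_le hq b _ hf.reflect

theorem energy_leftAct_path_sub_le [NeZero N] {q : ℝ} (hq : q ∈ Set.Icc (-1 : ℝ) 1) (b : Bool) (c : K × Bool)
    (u : List (K × Bool)) :
    energy (leftAct q b c (path N u) - optPath N (leftStep b c u))
      ≤ (u.length + 1) ^ 2 * (N : ENNReal)⁻¹ := by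
  rcases b with _ | _
  · have : leftAct q false c (path N u) - optPath N (leftStep false c u) = 0 := sub_self _
    rw [this, energy_zero]
    exact zero_le
  · have h0 : energy (leftRemove 0 c (path N u) - optPath N (leftStep true c u))
        ≤ (N : ENNReal)⁻¹ := by
      rcases u with _ | ⟨d, u⟩
      · have : leftRemove 0 c (path N []) - optPath N (leftStep true c []) = 0 := by
          funext i j w
          simp [leftRemove, path, optPath, leftStep]
        rw [this, energy_zero]
        exact zero_le
      · by_cases hcd : c = d
        · have : leftStep true c (d :: u) = some u := by simp [leftStep, hcd]
          rw [(leftRemove_zero_path_cons c d u).1 hcd, this]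
          simp [optPath, energy_zero]
        · have : leftStep true c (d :: u) = none := by simp [leftStep, hcd]
          rw [this]
          simpa [optPath] using (leftRemove_zero_path_cons (N := N) c d u).2 hcd
    -- The limit is subtracted from the term `m = 0`, so that all `u.length + 1` summands have
    -- energy at most `1/N`.
    have hsum : leftAct q true c (path N u) - optPath N (leftStep true c u)
        = ∑ m ∈ Finset.range (u.length + 1),
          if m = 0 then leftRemove 0 c (path N u) - optPath N (leftStep true c u)
          else (q : ℂ) ^ m • leftRemove m c (path N u) := by
      rw [leftAct, leftAnnihilate_eq_sum q c _ (supportedUpTo_path u), Finset.sum_range_succ',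
        Finset.sum_range_succ']
      simp [add_sub_assoc]
    rw [hsum]
    refine (energy_sum_le _ _).trans ?_
    refine (mul_le_mul_right (Finset.sum_le_sum (g := fun _ => (N : ENNReal)⁻¹)
      fun m _ => ?_) _).trans_eq ?_
    · split_ifs with hm
      · exact h0
      · obtain ⟨m, rfl⟩ := Nat.exists_eq_succ_of_ne_zero hm
        exact (energy_smul_le (enorm_pow_le_one hq _) _).trans
          (energy_leftRemove_succ_path_le m c u)
    · simp only [Finset.card_range, Finset.sum_const, nsmul_eq_mul]
      push_cast
      ring

theorem energy_sideAct_path_sub_le [NeZero N] {q : ℝ} (hq : q ∈ Set.Icc (-1 : ℝ) 1) (s : Side) (b : Bool)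
    (c : K × Bool) (u : List (K × Bool)) :
    energy (sideAct q s b c (path N u) - optPath N (sideStep s b c u))
      ≤ (u.length + 1) ^ 2 * (N : ENNReal)⁻¹ := by
  cases s with
  | left => exact energy_leftAct_path_sub_le hq b c u
  | right =>
    -- Reflection reverses a path and transposes its labels, which reduces the right side to the
    -- left estimate.
    have h : optPath N (sideStep .right b c u)
        = reflect (optPath N (leftStep b (flip c) (u.map flip).reverse)) := by
      rw [← List.map_reverse, leftStep_map flip_injective, sideStep]
      cases leftStep b c u.reverse with
      | none => rfl
      | some v => simp [optPath, reflect_path, Function.comp_def]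
    rw [h, sideAct, reflect_path, ← reflect_sub, energy_reflect]
    simpa using energy_leftAct_path_sub_le (N := N) hq b (flip c) (u.map flip).reverse

theorem exists_energy_evolve_sub_le {q : ℝ} (hq : q ∈ Set.Icc (-1 : ℝ) 1)
    (ts : List (K × Side × Deco)) :
    ∃ C : NNReal, ∀ (N : ℕ) [NeZero N],
      energy (evolve N q ts - optPath N (limitWord ts)) ≤ C * (N : ENNReal)⁻¹ := by
  induction ts with
  | nil =>
    refine ⟨0, fun N _ => ?_⟩
    have : evolve N q ([] : List (K × Side × Deco)) - optPath N (limitWord []) = 0 := sub_self _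
    rw [this, energy_zero]
    exact zero_le
  | cons t ts ih =>
    obtain ⟨C, hC⟩ := ih
    set A : NNReal := (ts.length + 1) ^ 2 with hA
    have hA' : (A : ENNReal) = (ts.length + 1) ^ 2 := by rw [hA]; push_cast; rfl
    -- `A * C` bounds the propagated old error, `A` the new error of acting on an exact path, and
    -- `2` comes from `energy_add_le`.
    refine ⟨2 * (A * C + A), fun N _ => ?_⟩
    set T : MatFun K N → MatFun K N := sideAct q t.2.1 t.2.2.isAdj (label t) with hT
    have h1 : energy (T (evolve N q ts - optPath N (limitWord ts)))
        ≤ A * (C * (N : ENNReal)⁻¹) := by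
      refine (energy_sideAct_le hq _ _ _
        ((supportedUpTo_evolve q ts).sub (supportedUpTo_optPath_limitWord ts))).trans ?_
      rw [hA']
      exact mul_le_mul_right (hC N) _
    have h2 : energy (T (optPath N (limitWord ts)) - optPath N (limitWord (t :: ts)))
        ≤ A * (N : ENNReal)⁻¹ := by
      cases hu : limitWord ts with
      | none =>
        have : T (optPath N none) - optPath N (limitWord (t :: ts)) = 0 := by
          rw [limitWord, hu, hT]
          simp [optPath, sideAct_zero]
        rw [this, energy_zero]
        exact zero_le
      | some u =>
        rw [limitWord, hu]
        refine (energy_sideAct_path_sub_le hq _ _ _ u).trans ?_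
        rw [hA']
        gcongr
        exact length_limitWord_le ts hu
    have h3 : evolve N q (t :: ts) - optPath N (limitWord (t :: ts))
        = T (evolve N q ts - optPath N (limitWord ts))
          + (T (optPath N (limitWord ts)) - optPath N (limitWord (t :: ts))) := by
      rw [hT, sideAct_sub, evolve]
      abel
    rw [h3]
    refine (energy_add_le _ _).trans ?_
    calc 2 * (energy (T (evolve N q ts - optPath N (limitWord ts)))
          + energy (T (optPath N (limitWord ts)) - optPath N (limitWord (t :: ts))))
        ≤ 2 * (A * (C * (N : ENNReal)⁻¹) + A * (N : ENNReal)⁻¹) := by gcongr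
      _ = _ := by push_cast; ring

/-! ### From energy to the normalized trace -/

/-- The normalized trace of the vacuum coefficients. -/
def traceCoeff (f : MatFun K N) : ℂ := (N : ℂ)⁻¹ * ∑ i, f i i []

theorem enorm_traceCoeff_sq_le [NeZero N] (f : MatFun K N) :
    ‖traceCoeff f‖ₑ ^ 2 ≤ (N : ENNReal)⁻¹ * energy f := by
  have h1 : ∑ i, ‖f i i []‖ₑ ^ 2 ≤ energy f := by
    refine Finset.sum_le_sum fun i _ => ?_
    refine le_trans ?_ (Finset.single_le_sum (f := fun j => ∑' w, ‖f i j w‖ₑ ^ 2)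
      (fun _ _ => zero_le) (Finset.mem_univ i))
    exact ENNReal.le_tsum (f := fun w => ‖f i i w‖ₑ ^ 2) []
  -- The squared normalization is `N⁻²`, and Cauchy–Schwarz over the `N` diagonal entries gives back
  -- only one factor `N`.
  rw [traceCoeff, ← scale_mul_scale, enorm_mul, enorm_mul, mul_pow, mul_pow, enorm_scale_sq]
  calc (N : ENNReal)⁻¹ * (N : ENNReal)⁻¹ * ‖∑ i, f i i []‖ₑ ^ 2
      ≤ (N : ENNReal)⁻¹ * (N : ENNReal)⁻¹ * ((Finset.univ : Finset (Fin N)).card * energy f) := by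
        gcongr
        exact (enorm_sum_sq_le _ _).trans (by gcongr)
    _ = (N : ENNReal)⁻¹ * ((N : ENNReal) * (N : ENNReal)⁻¹) * energy f := by
        rw [Finset.card_univ, Fintype.card_fin]; ring
    _ = _ := by rw [card_mul_inv, mul_one]

theorem traceCoeff_optPath [NeZero N] (o : Option (List (K × Bool))) [Decidable (o = some [])] :
    traceCoeff (optPath N o) = if o = some [] then 1 else 0 := by
  rcases o with _ | _ | ⟨c, u⟩
  · simp [traceCoeff, optPath]
  · simp [traceCoeff, optPath, path, NeZero.ne N]
  · simp [traceCoeff, optPath]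

theorem exists_norm_traceCoeff_evolve_sub_le {q : ℝ} (hq : q ∈ Set.Icc (-1 : ℝ) 1)
    (ts : List (K × Side × Deco)) [Decidable (limitWord ts = some [])] :
    ∃ C : ℝ, ∀ (N : ℕ) [NeZero N],
      ‖traceCoeff (evolve N q ts) - (if limitWord ts = some [] then 1 else 0)‖ ≤ C * (1 / N) := by
  obtain ⟨C, hC⟩ := exists_energy_evolve_sub_le hq ts
  -- The trace error is bounded in square by `C / N ^ 2`.
  refine ⟨Real.sqrt C, fun N _ => ?_⟩
  have hN : (N : NNReal) ≠ 0 := Nat.cast_ne_zero.2 (NeZero.ne N)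
  have h1 : traceCoeff (evolve N q ts) - (if limitWord ts = some [] then 1 else 0)
      = traceCoeff (evolve N q ts - optPath N (limitWord ts)) := by
    rw [← traceCoeff_optPath (N := N)]
    simp [traceCoeff, mul_sub]
  have h2 := (enorm_traceCoeff_sq_le (evolve N q ts - optPath N (limitWord ts))).trans
    (mul_le_mul_right (hC N) _)
  rw [← h1] at h2
  set z := traceCoeff (evolve N q ts) - (if limitWord ts = some [] then 1 else 0)
  have h3 : ‖z‖₊ ^ 2 ≤ (N : NNReal)⁻¹ * (C * (N : NNReal)⁻¹) := by
    rw [enorm_eq_nnnorm, ← ENNReal.coe_natCast N, ← ENNReal.coe_inv hN] at h2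
    exact_mod_cast h2
  have h4 : ‖z‖ ^ 2 ≤ (N : ℝ)⁻¹ * (C * (N : ℝ)⁻¹) := by exact_mod_cast h3
  refine abs_le_of_sq_le_sq' ?_ (by positivity) |>.2
  rw [mul_pow, Real.sq_sqrt C.coe_nonneg]
  refine h4.trans_eq ?_
  ring

end

/-! ### Words and noncommutative polynomials -/

theorem jointDistribution_wordMonomial {A ι : Type*} [Ring A] [Algebra ℂ A] (φ : A →ₗ[ℂ] ℂ)
    (Z : ι → A) (w : List ι) : jointDistribution φ Z (wordMonomial w) = φ (w.map Z).prod := by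
  simp [jointDistribution, wordMonomial, map_list_prod, Function.comp_def]

theorem span_wordMonomial (ι : Type*) :
    Submodule.span ℂ (Set.range (wordMonomial : List ι → FreeAlgebra ℂ ι)) = ⊤ := by
  rw [eq_top_iff, ← Algebra.top_toSubmodule, ← FreeAlgebra.adjoin_range_ι,
    Algebra.adjoin_eq_span]
  refine Submodule.span_mono fun x hx => ?_
  obtain ⟨l, hl, rfl⟩ := Submonoid.exists_list_of_mem_closure hx
  have : l ∈ Set.range (List.map (FreeAlgebra.ι ℂ (X := ι))) := by
    rw [Set.range_list_map]; exact hl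
  obtain ⟨w, rfl⟩ := this
  exact ⟨w, rfl⟩

/-! ### The limit operators -/

section

variable {L : Type*}

open Classical in
/-- The indicator function of a word, and zero for `none`. -/
def wordIndicator : Option (List L) → List L → ℂ
  | none, _ => 0
  | some u, w => if u = w then 1 else 0

theorem wordReverse_wordIndicator (o : Option (List L)) :
    wordReverse (wordIndicator o) = wordIndicator (o.map List.reverse) := by
  classical
  ext w
  cases o with
  | none => simp [wordReverse, wordIndicator]
  | some u => simp [wordReverse, wordIndicator, List.reverse_eq_iff]

theorem wordCreation_wordIndicator (c : L) (o : Option (List L)) :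
    wordCreation c (wordIndicator o) = wordIndicator (o.bind (leftStep false c)) := by
  classical
  ext w
  cases o with
  | none => cases w <;> simp [wordCreation, wordIndicator]
  | some u =>
    cases w with
    | nil => simp [wordCreation, wordIndicator, leftStep]
    | cons y w =>
      by_cases h : y = c
      · simp [wordCreation, wordIndicator, leftStep, h]
      · simp [wordCreation, wordIndicator, leftStep, h, Ne.symm h]

theorem wordAnnihilation_zero (c : L) (f : List L → ℂ) (w : List L) :
    wordAnnihilation 0 c f w = f (c :: w) := by
  rw [wordAnnihilation, Finset.sum_eq_single 0] <;> simp +contextual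

theorem wordAnnihilation_wordIndicator (c : L) (o : Option (List L)) :
    wordAnnihilation 0 c (wordIndicator o) = wordIndicator (o.bind (leftStep true c)) := by
  classical
  ext w
  rw [wordAnnihilation_zero]
  rcases o with _ | _ | ⟨d, u⟩
  · simp [wordIndicator]
  · simp [wordIndicator, leftStep]
  · by_cases h : c = d
    · simp [wordIndicator, leftStep, h]
    · simp [wordIndicator, leftStep, h, Ne.symm h]

theorem bind_sideStep_right (b : Bool) (c : L) (o : Option (List L)) :
    o.bind (sideStep .right b c) = ((o.map List.reverse).bind (leftStep b c)).map List.reverse := by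
  cases o <;> rfl

variable {H : Type*} [NormedAddCommGroup H] [InnerProductSpace ℂ H]

theorem coeff_creation_wordIndicator {g : L → H} (hg : Orthonormal ℂ g) (s : Side) (c : L)
    {o : Option (List L)} {η : AlgFock H} (hη : coeff g η = wordIndicator o) :
    coeff g (algCreation s (g c) η) = wordIndicator (o.bind (sideStep s false c)) := by
  cases s with
  | left => rw [coeff_creation_left hg, hη, wordCreation_wordIndicator]; rfl
  | right =>
    rw [coeff_creation_right hg, hη, wordReverse_wordIndicator, wordCreation_wordIndicator,
      wordReverse_wordIndicator, bind_sideStep_right]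

theorem coeff_annihilation_wordIndicator {g : L → H} (s : Side) (c : L)
    {o : Option (List L)} {η : AlgFock H} (hη : coeff g η = wordIndicator o) :
    coeff g (algAnnihilation 0 s (g c) η) = wordIndicator (o.bind (sideStep s true c)) := by
  cases s with
  | left => rw [coeff_annihilation_left, hη, wordAnnihilation_wordIndicator]; rfl
  | right =>
    rw [coeff_annihilation_right, hη, wordReverse_wordIndicator, wordAnnihilation_wordIndicator,
      wordReverse_wordIndicator, bind_sideStep_right]

variable {K : Type*}

/-- The two families of vectors of the limit, as one family indexed by labels. -/
def limitVector (h ht : K → H) (c : K × Bool) : H := if c.2 then ht c.1 else h c.1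

theorem orthonormal_limitVector {h ht : K → H} (hh : Orthonormal ℂ (Sum.elim h ht)) :
    Orthonormal ℂ (limitVector h ht) := by
  have : limitVector h ht
      = Sum.elim h ht ∘ fun c : K × Bool => if c.2 then Sum.inr c.1 else Sum.inl c.1 := by
    funext ⟨k, b⟩
    cases b <;> rfl
  rw [this]
  refine hh.comp _ ?_
  rintro ⟨k, _ | _⟩ ⟨k', _ | _⟩ <;> simp

/-- At `q = 0` each operator sends a basis tensor to a basis tensor or to zero, so a single optional
word records the state. -/
theorem exists_limitOperators_prod_vacuum {h ht : K → H} (hh : Orthonormal ℂ (Sum.elim h ht))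
    (ts : List (K × Side × Deco)) :
    ∃ η : AlgFock H, (ts.map (limitOperators h ht)).prod (vacuum 0 H) = (radical 0 H).mkQ η ∧
      coeff (limitVector h ht) η = wordIndicator (limitWord ts) := by
  classical
  have hg := orthonormal_limitVector hh
  induction ts with
  | nil =>
    refine ⟨algVacuum H, rfl, ?_⟩
    ext w
    rw [coeff_algVacuum]
    simp [wordIndicator, limitWord, eq_comm]
  | cons t ts ih =>
    obtain ⟨η, hη, hc⟩ := ih
    obtain ⟨k, s, w⟩ := t
    rw [List.map_cons, List.prod_cons, Module.End.mul_apply, hη]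
    cases w with
    | plain => exact ⟨_, rfl, coeff_creation_wordIndicator hg s (k, false) hc⟩
    | adj => exact ⟨_, rfl, coeff_annihilation_wordIndicator s (k, false) hc⟩
    | tr => exact ⟨_, rfl, coeff_creation_wordIndicator hg s (k, true) hc⟩
    | trAdj => exact ⟨_, rfl, coeff_annihilation_wordIndicator s (k, true) hc⟩

theorem vacuumState_limitOperators_prod {h ht : K → H} (hh : Orthonormal ℂ (Sum.elim h ht))
    (ts : List (K × Side × Deco)) [Decidable (limitWord ts = some [])] :
    vacuumState 0 H (ts.map (limitOperators h ht)).prod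
      = if limitWord ts = some [] then 1 else 0 := by
  obtain ⟨η, hη, hc⟩ := exists_limitOperators_prod_vacuum hh ts
  rw [vacuumState, LinearMap.comp_apply, LinearMap.applyₗ_apply_apply, hη,
    vacuumCoeff_mkQ 0 (limitVector h ht), hc]
  have key : ∀ (o : Option (List (K × Bool))) [Decidable (o = some [])],
      wordIndicator o [] = if o = some [] then 1 else 0 := by
    rintro (_ | _ | ⟨c, u⟩) _ <;> simp [wordIndicator]
  exact key _

end

/-! ### The matrices of creation and annihilation operators -/

section

variable {H : Type*} [NormedAddCommGroup H] [InnerProductSpace ℂ H] {K : Type*} {N : ℕ}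

/-- The entries of the matrices, as operators on the algebraic Fock space. -/
def algEntries (q : ℝ) (s : Side) (g : K × Fin N × Fin N → H) (b : Bool) (c : K × Bool)
    (i j : Fin N) : Module.End ℂ (AlgFock H) :=
  match b with
  | false => algCreation s (g (edge c i j))
  | true => algAnnihilation q s (g (edge c j i))

theorem entries_mkQ (q : ℝ) (s : Side) (h : K → Fin N → Fin N → H) (k : K) (w : Deco)
    (i j : Fin N) (x : AlgFock H) :
    entries q s (h k) w i j ((radical q H).mkQ x)
      = (radical q H).mkQ
          (algEntries q s (fun x => h x.1 x.2.1 x.2.2) w.isAdj (k, w.isTr) i j x) := by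
  cases w <;> rfl

theorem leftAct_eq_scale_smul (q : ℝ) (b : Bool) (c : K × Bool) (f : MatFun K N) (i j : Fin N) :
    leftAct q b c f i j = scale N • ∑ l, match b with
      | false => wordCreation (edge c i l) (f l j)
      | true => wordAnnihilation q (edge c l i) (f l j) := by
  ext w
  cases b <;> simp [leftAct, leftCreate, leftAnnihilate]

theorem coeff_sum_algEntries_left (q : ℝ) {g : K × Fin N × Fin N → H} (hg : Orthonormal ℂ g)
    (b : Bool) (c : K × Bool) {η : Matrix (Fin N) (Fin N) (AlgFock H)} {f : MatFun K N}
    (hη : ∀ i j, coeff g (η i j) = f i j) (i j : Fin N) :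
    coeff g (scale N • ∑ l, algEntries q .left g b c i l (η l j))
      = sideAct q .left b c f i j := by
  rw [coeff_smul, coeff_sum, sideAct, leftAct_eq_scale_smul]
  congr 1
  refine Finset.sum_congr rfl fun l _ => ?_
  cases b with
  | false => exact (coeff_creation_left hg _ _).trans (by rw [hη])
  | true => exact (coeff_annihilation_left q g _ _).trans (by rw [hη])

theorem coeff_sum_algEntries_right (q : ℝ) {g : K × Fin N × Fin N → H} (hg : Orthonormal ℂ g)
    (b : Bool) (c : K × Bool) {η : Matrix (Fin N) (Fin N) (AlgFock H)} {f : MatFun K N}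
    (hη : ∀ i j, coeff g (η i j) = f i j) (i j : Fin N) :
    coeff g (scale N • ∑ l, algEntries q .right g b c l j (η i l))
      = sideAct q .right b c f i j := by
  have hrev : ∀ (z : ℂ) (F : Fin N → List (K × Fin N × Fin N) → ℂ),
      wordReverse (z • ∑ l, F l) = z • ∑ l, wordReverse (F l) := by
    intro z F; ext w; simp [wordReverse]
  -- Transposition turns the right matrix action into the left one with flipped labels.
  rw [coeff_smul, coeff_sum, sideAct, reflect, leftAct_eq_scale_smul, hrev]
  congr 1
  refine Finset.sum_congr rfl fun l _ => ?_
  cases b with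
  | false => exact (coeff_creation_right hg _ _).trans (by rw [hη]; simp only [edge_flip]; rfl)
  | true => exact (coeff_annihilation_right q g _ _).trans (by rw [hη]; simp only [edge_flip]; rfl)

/-- Full Fock coefficients need not descend to the quotient by the radical, for instance at `q = 1`.
A representative in the algebraic Fock space is therefore carried along. -/
theorem exists_bimatrix_prod_vacuum (q : ℝ) {h : K → Fin N → Fin N → H}
    (hh : Orthonormal ℂ fun x : K × Fin N × Fin N => h x.1 x.2.1 x.2.2)
    (ts : List (K × Side × Deco)) :
    ∃ η : Matrix (Fin N) (Fin N) (AlgFock H),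
      (ts.map (bimatrix q N h)).prod (Matrix.diagonal fun _ => vacuum q H)
        = η.map (radical q H).mkQ ∧
      ∀ i j, coeff (fun x : K × Fin N × Fin N => h x.1 x.2.1 x.2.2) (η i j)
        = evolve N q ts i j := by
  classical
  induction ts with
  | nil =>
    refine ⟨Matrix.diagonal fun _ => algVacuum H, ?_, ?_⟩
    · rw [Matrix.diagonal_map (map_zero _)]; rfl
    · intro i j
      ext w
      by_cases hij : i = j
      · subst hij
        rw [Matrix.diagonal_apply_eq, coeff_algVacuum]
        simp [evolve, path]
      · rw [Matrix.diagonal_apply_ne _ hij, coeff_zero]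
        simp [evolve, path, hij]
  | cons t ts ih =>
    obtain ⟨η, hη, hc⟩ := ih
    obtain ⟨k, s, w⟩ := t
    rw [List.map_cons, List.prod_cons, Module.End.mul_apply, hη]
    cases s with
    | left =>
      refine ⟨Matrix.of fun i j => scale N • ∑ l, algEntries q .left _ w.isAdj (k, w.isTr) i l
        (η l j), ?_, coeff_sum_algEntries_left q hh _ _ hc⟩
      ext i j
      rw [Matrix.map_apply, Matrix.of_apply, map_smul, map_sum]
      simp only [← entries_mkQ]
      rfl
    | right =>
      refine ⟨Matrix.of fun i j => scale N • ∑ l, algEntries q .right _ w.isAdj (k, w.isTr) l j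
        (η i l), ?_, coeff_sum_algEntries_right q hh _ _ hc⟩
      ext i j
      rw [Matrix.map_apply, Matrix.of_apply, map_smul, map_sum]
      simp only [← entries_mkQ]
      rfl

theorem traceState_bimatrix_prod (q : ℝ) {h : K → Fin N → Fin N → H}
    (hh : Orthonormal ℂ fun x : K × Fin N × Fin N => h x.1 x.2.1 x.2.2)
    (ts : List (K × Side × Deco)) :
    traceState q H N (ts.map (bimatrix q N h)).prod = traceCoeff (evolve N q ts) := by
  obtain ⟨η, hη, hc⟩ := exists_bimatrix_prod_vacuum q hh ts
  have h1 : matrixExpectation N (vacuum q H) (vacuumCoeff q H) (ts.map (bimatrix q N h)).prod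
      = Matrix.of fun i j => evolve N q ts i j [] := by
    rw [matrixExpectation, LinearMap.comp_apply, LinearMap.applyₗ_apply_apply, hη]
    ext i j
    rw [LinearMap.mapMatrix_apply, Matrix.map_apply, Matrix.map_apply,
      vacuumCoeff_mkQ q fun x : K × Fin N × Fin N => h x.1 x.2.1 x.2.2, hc, Matrix.of_apply]
  rw [traceState, LinearMap.smul_apply, LinearMap.comp_apply, h1]
  rfl

end

end

end QBiMatrix

/-! ### Assembly of the theorem -/

theorem theorem6p1
    {K : Type*} (q : ℝ) (hq : q ∈ Set.Icc (-1 : ℝ) 1)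
    (H : ℕ → Type*) [∀ N, NormedAddCommGroup (H N)] [∀ N, InnerProductSpace ℂ (H N)]
    (h : ∀ N : ℕ, K → Fin N → Fin N → H N)
    (hh : ∀ N : ℕ, Orthonormal ℂ fun x : K × Fin N × Fin N => h N x.1 x.2.1 x.2.2)
    (H₀ : Type*) [NormedAddCommGroup H₀] [InnerProductSpace ℂ H₀]
    (h₀ ht₀ : K → H₀) (hh₀ : Orthonormal ℂ (Sum.elim h₀ ht₀)) :
    (∀ P : FreeAlgebra ℂ (K × QBiMatrix.Side × QBiMatrix.Deco),
      Tendsto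
        (fun N : ℕ =>
          QBiMatrix.jointDistribution (QBiMatrix.traceState q (H N) N)
            (QBiMatrix.bimatrix q N (h N)) P)
        atTop
        (𝓝 (QBiMatrix.jointDistribution (QBiMatrix.vacuumState 0 H₀)
          (QBiMatrix.limitOperators h₀ ht₀) P))) ∧
    ∀ w : List (K × QBiMatrix.Side × QBiMatrix.Deco),
      (fun N : ℕ =>
        QBiMatrix.jointDistribution (QBiMatrix.traceState q (H N) N)
            (QBiMatrix.bimatrix q N (h N)) (QBiMatrix.wordMonomial w)
          - QBiMatrix.jointDistribution (QBiMatrix.vacuumState 0 H₀)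
            (QBiMatrix.limitOperators h₀ ht₀) (QBiMatrix.wordMonomial w))
        =O[atTop] fun N : ℕ => (1 : ℝ) / N := by
  classical
  have hO : ∀ w : List (K × QBiMatrix.Side × QBiMatrix.Deco),
      (fun N : ℕ =>
        QBiMatrix.jointDistribution (QBiMatrix.traceState q (H N) N)
            (QBiMatrix.bimatrix q N (h N)) (QBiMatrix.wordMonomial w)
          - QBiMatrix.jointDistribution (QBiMatrix.vacuumState 0 H₀)
            (QBiMatrix.limitOperators h₀ ht₀) (QBiMatrix.wordMonomial w))
        =O[atTop] fun N : ℕ => (1 : ℝ) / N := by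
    intro w
    obtain ⟨C, hC⟩ := QBiMatrix.exists_norm_traceCoeff_evolve_sub_le hq w
    refine IsBigO.of_bound C ?_
    filter_upwards [eventually_ne_atTop 0] with N hN
    have : NeZero N := ⟨hN⟩
    rw [QBiMatrix.jointDistribution_wordMonomial, QBiMatrix.jointDistribution_wordMonomial,
      QBiMatrix.vacuumState_limitOperators_prod hh₀, QBiMatrix.traceState_bimatrix_prod q (hh N),
      Real.norm_of_nonneg (by positivity : (0 : ℝ) ≤ 1 / N)]
    exact hC N
  refine ⟨fun P => ?_, hO⟩
  -- Monomials span the free algebra and both sides are linear in `P`, so the word estimate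
  -- suffices.
  have hP : P ∈ Submodule.span ℂ (Set.range QBiMatrix.wordMonomial) :=
    QBiMatrix.span_wordMonomial (K × QBiMatrix.Side × QBiMatrix.Deco) ▸ Submodule.mem_top
  induction hP using Submodule.span_induction with
  | mem P hP =>
    obtain ⟨w, rfl⟩ := hP
    exact tendsto_sub_nhds_zero_iff.1 ((hO w).trans_tendsto tendsto_one_div_atTop_nhds_zero_nat)
  | zero => simp only [map_zero]; exact tendsto_const_nhds
  | add P Q _ _ hP hQ => simp only [map_add]; exact hP.add hQ
  | smul c P _ hP => simp only [map_smul]; exact hP.const_smul c
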